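/- **Theorem 3.** *Setting.* Let $f$ be a bounded probability density on $\mathbb{R}^d$ with respect to Lebesgue measure $\lambda$, $F(dx)=f(x)\,dx$, $X\sim F$, and assume $\mathbb{P}\{f(X)=t\}=0$ for all $t>0$. Put $Q^*(\alpha)=\inf\{t:\mathbb{P}(f(X)\le t)\ge 1-\alpha\}$ and $\mathrm{MV}^*(\alpha)=\lambda\{x: f(x)\ge t_\alpha\}$ with $t_\alpha=\inf\{t:\mathbb{P}(f(X)\ge t)\le\alpha\}$. Assume that $\mathrm{MV}^*$ is differentiable on $[0,1)$ (one-sidedly at $0$) with $\mathrm{MV}^{*\prime}=1/Q^*$, and that $$\|\mathrm{MV}^{*\prime}\|_{L\log L}:=\int_0^1\bigl(1+\log^+|\mathrm{MV}^{*\prime}(\alpha)|\bigr)\,|\mathrm{MV}^{*\prime}(\alpha)|\,d\alpha<\infty .$$ Let $\varepsilon,\delta\in(0,1)$ and let $\mathcal{G}$ be a class of Borel sets of finite Lebesgue measure such that for every $\alpha\in[0,1-\varepsilon]$ it contains a minimum volume set $\Omega^*_\alpha$, i.e. a minimizer of $\lambda(\Omega)$ over all measurable $\Omega$ with $F(\Omega)\ge\alpha$.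 For independent Rademacher signs $\varepsilon_i$ independent of the i.i.d. sample $X_1,X_2,\dots\sim F$, assume that the suprema below are measurable and that the Rademacher averages $$\mathcal{R}_n=\mathbb{E}\Bigl[\sup_{\Omega\in\mathcal{G}}\tfrac1n\Bigl|\sum_{i=1}^n\varepsilon_i\mathbb{I}\{X_i\in\Omega\}\Bigr|\Bigr]$$ satisfy $\sup_{n\ge1}\sqrt n\,\mathcal{R}_n<\infty$. Set $\phi_n(\delta)=2\mathcal{R}_n+\sqrt{\log(1/\delta)/(2n)}$. *Algorithm.* Fix $n\ge1$, let $\widehat F$ be the empirical distribution of $X_1,\dots,X_n$, and for $\alpha\in[0,1-\varepsilon]$ let $\widehat\Omega_\alpha$ be a minimizer of $\lambda(\Omega)$ over $\Omega\in\mathcal{G}$ with $\widehat F(\Omega)\ge\alpha-\phi_n(\delta)$ (minimizers are assumed to exist whenever the constraint can be met; otherwise $\widehat\Omega_\alpha$ is arbitrary). Take $\tau=5\phi_n(\delta)/Q^*(1-\varepsilon)$, $\alpha_{j,k}=k(1-\varepsilon)/2^j$, $j_{\max}=\lfloor\log n/\log 2\rfloor+1$. Starting from the root $(0,0)$, a node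 $(j,k)$, representing $I_{j,k}=[\alpha_{j,k},\alpha_{j,k+1})$, is split into $(j+1,2k)$ and $(j+1,2k+1)$ if $j<j_{\max}$ and $\lambda(\widehat\Omega_{\alpha_{j,k+1}})-\lambda(\widehat\Omega_{\alpha_{j,k}})>\tau$; otherwise it is a leaf. Let $\mathrm{card}(\widehat\sigma_\tau)$ be the number of leaves and $\widehat{\mathrm{MV}^*}(\alpha)=\sum_{I_{j,k}\text{ leaf}}\lambda(\widehat\Omega_{\alpha_{j,k+1}})\,\mathbb{I}\{\alpha\in I_{j,k}\}$. *Claim.* There are constants $C_{\varepsilon,\delta}>0$, depending only on $(\varepsilon,\delta)$, and $C_v>0$, depending only on $v>0$, such that in every such setting and for every $n\ge 1$, with probability at least $1-\delta$, the following hold simultaneously: $$\sup_{\alpha\in[0,1-\varepsilon]}\bigl\{\widehat{\mathrm{MV}^*}(\alpha)-\mathrm{MV}^*(\alpha)\bigr\}\le\frac{1}{Q^*(1-\varepsilon)}\Bigl(11\,\phi_n(\delta)+\frac1n\Bigr),$$ $$\mathrm{card}(\widehat\sigma_\tau)\le C_{\varepsilon,\delta}\,Q^*(1-\varepsilon)\,\frac{\|\mathrm{MV}^{*\prime}\|_{L\log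 L}}{\phi_n(\delta)},$$ and, for every $v>0$ with $\lambda\{f>0\}\ge v$, $$\mathrm{card}(\widehat\sigma_\tau)\le \max\Bigl\{1,\;C_v\,Q^*(1-\varepsilon)\,\frac{\|\mathrm{MV}^{*\prime}\|_{L\log L}}{\phi_n(\delta)}\Bigr\}.$$ -/

import Mathlib

open MeasureTheory ProbabilityTheory

namespace MassVolume

noncomputable section

/-- The feature space `ℝ^d`. A smaller feature space is covered by extending the density by `0`. -/
abbrev Space (d : ℕ) : Type := EuclideanSpace ℝ (Fin d)

/-- `f` is a probability density with respect to Lebesgue measure. -/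
structure IsProbDensity {d : ℕ} (f : Space d → ℝ) : Prop where
  measurable : Measurable f
  nonneg : ∀ x, 0 ≤ f x
  lintegral_eq_one : ∫⁻ x, ENNReal.ofReal (f x) = 1

/-- The distribution `F(dx) = f(x) dx`. -/
def law {d : ℕ} (f : Space d → ℝ) : Measure (Space d) :=
  volume.withDensity fun x => ENNReal.ofReal (f x)

/-- The density is bounded. -/
def BoundedDensity {d : ℕ} (f : Space d → ℝ) : Prop := ∃ M : ℝ, ∀ x, f x ≤ M

/-- The density has no flat parts. -/
def NoFlatParts {d : ℕ} (f : Space d → ℝ) : Prop := ∀ t > 0, law f {x | f x = t} = 0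

/-- `Q(s, α)`: the quantile at level `1 - α` of `s(X)` for `X ∼ F`. -/
def quantile {d : ℕ} (F : Measure (Space d)) (s : Space d → ℝ) (α : ℝ) : ℝ :=
  sInf {t : ℝ | 1 - α ≤ F.real {x | s x ≤ t}}

/-- The generalized inverse at `α` of the mass function `t ↦ F {s ≥ t}`. -/
def massInv {d : ℕ} (F : Measure (Space d)) (s : Space d → ℝ) (α : ℝ) : ℝ :=
  sInf {t : ℝ | F.real {x | t ≤ s x} ≤ α}

/-- The Mass Volume curve of `s`: the volume of the level set of `s` at level `massInv F s α`. -/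
def mvCurve {d : ℕ} (F : Measure (Space d)) (s : Space d → ℝ) (α : ℝ) : ℝ :=
  volume.real {x | massInv F s α ≤ s x}

/-- `Q* = Q(f, ·)`. -/
def quantileStar {d : ℕ} (f : Space d → ℝ) (α : ℝ) : ℝ := quantile (law f) f α

/-- `MV* = MV_f`. -/
def mvStar {d : ℕ} (f : Space d → ℝ) (α : ℝ) : ℝ := mvCurve (law f) f α

/-- `A` is a minimum volume set of mass at least `α`: it solves
`min λ(A)` subject to `F(A) ≥ α` over all measurable sets. -/
def IsMinVolSet {d : ℕ} (F : Measure (Space d)) (α : ℝ) (A : Set (Space d)) : Prop :=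
  MeasurableSet A ∧ α ≤ F.real A ∧
    ∀ B : Set (Space d), MeasurableSet B → α ≤ F.real B → volume A ≤ volume B

/-- The integrand of the `L log L` functional, `(1 + log⁺ |y|) |y|`. -/
def lLogLFun (y : ℝ) : ℝ := (1 + Real.posLog |y|) * |y|

/-- `g` belongs to `L log L` of the unit interval. -/
def MemLLogL (g : ℝ → ℝ) : Prop := IntegrableOn (fun α => lLogLFun (g α)) (Set.Ioo 0 1)

/-- `‖g‖_{L log L} = ∫₀¹ (1 + log⁺ |g|) |g|`. -/
def lLogLNorm (g : ℝ → ℝ) : ℝ := ∫ α in Set.Ioo (0 : ℝ) 1, lLogLFun (g α)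

/-- `MV*` is differentiable on `[0,1)` (one-sidedly at `0`) with derivative `1 / Q*`,
and this derivative belongs to `L log L`. -/
def MVDerivLLogL {d : ℕ} (f : Space d → ℝ) : Prop :=
  (∀ α ∈ Set.Ico (0 : ℝ) 1,
    HasDerivWithinAt (mvStar f) (1 / quantileStar f α) (Set.Ico 0 1) α) ∧
  MemLLogL (deriv (mvStar f))

/-- `sup_{A ∈ 𝒢} (1/n) |∑ eᵢ 1{xᵢ ∈ A}|` for signs `e` and points `x`. -/
def signedSup {d : ℕ} (𝒢 : Set (Set (Space d))) (n : ℕ) (e : Fin n → ℤˣ)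
    (x : Fin n → Space d) : ℝ :=
  ⨆ A : 𝒢, (1 / (n : ℝ)) * |∑ i, ((e i : ℤ) : ℝ) * (A : Set (Space d)).indicator 1 (x i)|

/-- A class of measurable sets of finite volume for which the suprema
entering the Rademacher averages are random variables. -/
structure IsSetClass {d : ℕ} (𝒢 : Set (Set (Space d))) : Prop where
  measurableSet : ∀ A ∈ 𝒢, MeasurableSet A
  volume_lt_top : ∀ A ∈ 𝒢, volume A < ⊤
  measurable_signedSup : ∀ (n : ℕ) (e : Fin n → ℤˣ), Measurable (signedSup 𝒢 n e)

/-- The Rademacher average: the expectation of `signedSup` when the signs are uniform and the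
points are independent with law `F`, independent of the signs. -/
def rademacherAvg {d : ℕ} (F : Measure (Space d)) (𝒢 : Set (Set (Space d))) (n : ℕ) : ℝ :=
  (1 / 2 ^ n) * ∑ e : Fin n → ℤˣ, ∫ x, signedSup 𝒢 n e x ∂(Measure.pi fun _ => F)

/-- The penalty `φ_n(δ) = 2 R_n + √(log(1/δ) / (2n))`. -/
def penalty {d : ℕ} (F : Measure (Space d)) (𝒢 : Set (Set (Space d))) (n : ℕ) (δ : ℝ) : ℝ :=
  2 * rademacherAvg F 𝒢 n + Real.sqrt (Real.log (1 / δ) / (2 * n))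

/-- The empirical mass of `A` for the sample `x`. -/
def empMass {d n : ℕ} (x : Fin n → Space d) (A : Set (Space d)) : ℝ :=
  (1 / (n : ℝ)) * ∑ i, A.indicator 1 (x i)

/-- `A` solves `min λ(A)` over `A ∈ 𝒢` subject to (empirical mass of `A`) `≥ α - φ`. -/
def IsEmpMinVolSet {d n : ℕ} (𝒢 : Set (Set (Space d))) (φ : ℝ) (x : Fin n → Space d) (α : ℝ)
    (A : Set (Space d)) : Prop :=
  A ∈ 𝒢 ∧ α - φ ≤ empMass x A ∧ ∀ B ∈ 𝒢, α - φ ≤ empMass x B → volume A ≤ volume B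

/-- `Ωhat` assigns to each sample of size `n` and each level `α ∈ [0, 1-ε]` an empirical minimum
volume set, whenever the constraint can be met at all. -/
def IsEmpMinVolEstimator {d : ℕ} (𝒢 : Set (Set (Space d))) (φ ε : ℝ) (n : ℕ)
    (Ωhat : (Fin n → Space d) → ℝ → Set (Space d)) : Prop :=
  ∀ x : Fin n → Space d, ∀ α ∈ Set.Icc (0 : ℝ) (1 - ε),
    (∃ B ∈ 𝒢, α - φ ≤ empMass x B) → IsEmpMinVolSet 𝒢 φ x α (Ωhat x α)

/-- `α ↦ λ(Ωhat_α)` for the sample `x`. -/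
def empVol {d n : ℕ} (Ωhat : (Fin n → Space d) → ℝ → Set (Space d)) (x : Fin n → Space d)
    (α : ℝ) : ℝ := volume.real (Ωhat x α)

/-- The dyadic level `α_{j,k} = k (1-ε) / 2^j`; the node `(j,k)` stands for the interval
`[α_{j,k}, α_{j,k+1})`. -/
def dyadicLevel (ε : ℝ) (j k : ℕ) : ℝ := k * (1 - ε) / 2 ^ j

/-- The leaves of the tree grown below the node `(j,k)` when at most `m` further depths are allowed:
a node is split into `(j+1,2k)` and `(j+1,2k+1)` when `m > 0` and the increment of the volume
function `vol` over its interval exceeds `τ`. -/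
def leavesBelow (vol : ℝ → ℝ) (ε τ : ℝ) : ℕ → ℕ → ℕ → Finset (ℕ × ℕ)
  | 0, j, k => {(j, k)}
  | m + 1, j, k =>
    if τ < vol (dyadicLevel ε j (k + 1)) - vol (dyadicLevel ε j k) then
      leavesBelow vol ε τ m (j + 1) (2 * k) ∪ leavesBelow vol ε τ m (j + 1) (2 * k + 1)
    else {(j, k)}

/-- The maximal depth `⌊log n / log 2⌋ + 1`. -/
def maxDepth (n : ℕ) : ℕ := Nat.log 2 n + 1

/-- The leaves output by the adaptive algorithm, started at the root `(0,0)`. -/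
def adaptiveLeaves (vol : ℝ → ℝ) (ε τ : ℝ) (n : ℕ) : Finset (ℕ × ℕ) :=
  leavesBelow vol ε τ (maxDepth n) 0 0

/-- The piecewise constant estimate of `MV*` output by the adaptive algorithm. -/
def adaptiveMV (vol : ℝ → ℝ) (ε τ : ℝ) (n : ℕ) (α : ℝ) : ℝ :=
  ∑ p ∈ adaptiveLeaves vol ε τ n,
    (Set.Ico (dyadicLevel ε p.1 p.2) (dyadicLevel ε p.1 (p.2 + 1))).indicator
      (fun _ => vol (dyadicLevel ε p.1 (p.2 + 1))) α

/-- `τ = 5 φ_n(δ) / Q*(1-ε)`. -/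
def tolerance {d : ℕ} (f : Space d → ℝ) (𝒢 : Set (Set (Space d))) (n : ℕ) (δ ε : ℝ) : ℝ :=
  5 * penalty (law f) 𝒢 n δ / quantileStar f (1 - ε)

end

end MassVolume

/-! Everything is deterministic on the event that, uniformly over `𝒢`, empirical and true masses
differ by at most `φ = φ_n(δ)`. Symmetrization with a ghost sample bounds the mean of this supremum
by `2 R_n`, and McDiarmid's inequality adds the square root term, so the event has probability at
least `1 - δ` (`one_sub_le_measure_empDev_le`).

On it, with `Q = Q*(1-ε)`, the empirical volume at level `α` lies between `MV*(α) - 2φ/Q` and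
`MV*(α)` (`empVol_mem_Icc`). The upper bound holds because a true minimum volume set in `𝒢`
satisfies the empirical constraint. For the lower bound, the selected set has true mass at least `α
- 2φ`, level sets of `f` minimize volume, and the slope `1/Q*` of `MV*` is at most `1/Q` on `[0,
1-ε]`.

The error bound is read off the leaf containing `α`: its increment is at most `τ = 5φ/Q`, or it has
maximal depth and width at most `1/n`.

For the leaf count, a split at tolerance `5φ/Q` forces an increment of `MV*` above `η = 3φ/Q` on the
same dyadic interval, so such intervals are counted at every depth. The slope bound excludes them
once `2^j > 1/(3φ)`, which leaves `O(1/φ)`; since `ε ≤ Q ‖MV*'‖`, this gives the constant in `(ε,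
δ)`. For the constant in `v`, an increment above `η` at depth `j` must draw at least `η/2` from the
part of `g = MV*'` above height `2^j η / 2` (`splitCount_mul_le`). Depths with `2^j η ≤ v` are
counted trivially. In the sum over the others, a point `x` is charged once for each `j` with `v <
2^j η ≤ 2 g(x)`, a number of times logarithmic in `g(x)/v`, whence `L log L` (`sum_splitCount_le`).
The cut-off is harmless because `v ≤ λ{f > 0} ≤ ∫ g ≤ ‖g‖`. -/

namespace MassVolume

/-! ### McDiarmid's inequality -/

/-- The exponential moment bound behind McDiarmid's inequality, for a function on a product space
each of whose coordinates changes it by at most `c`. -/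
theorem integral_exp_le_of_boundedDiff {S : Type*} [MeasurableSpace S] (μ : Measure S)
    [IsProbabilityMeasure μ] {c : ℝ} (hc : 0 ≤ c) (t : ℝ) (n : ℕ) :
    ∀ Z : (Fin n → S) → ℝ, Measurable Z → (∃ M, ∀ x, |Z x| ≤ M) →
      (∀ x i y, |Z (Function.update x i y) - Z x| ≤ c) →
      ∫ x, Real.exp (t * (Z x - ∫ y, Z y ∂(Measure.pi fun _ => μ))) ∂(Measure.pi fun _ => μ) ≤
        Real.exp (n * (c / 2) ^ 2 * t ^ 2 / 2) := by
  induction n with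
  | zero =>
    intro Z _ _ _
    simp [integral_unique]
  | succ n ih =>
    intro Z hZ ⟨M, hM⟩ hd
    set π : Measure (Fin n → S) := Measure.pi fun _ => μ with hπ
    have hmp : MeasurePreserving (MeasurableEquiv.piFinSuccAbove (fun _ : Fin (n + 1) => S) 0).symm
        (μ.prod π) (Measure.pi fun _ => μ) :=
      (measurePreserving_piFinSuccAbove (fun _ : Fin (n + 1) => μ) 0).symm
    have hcons : ∀ p : S × (Fin n → S),
        (MeasurableEquiv.piFinSuccAbove (fun _ : Fin (n + 1) => S) 0).symm p =
          (Fin.cons p.1 p.2 : Fin (n + 1) → S) := by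
      intro p
      simp [MeasurableEquiv.piFinSuccAbove, Fin.insertNthEquiv]
    set Y : S × (Fin n → S) → ℝ := fun p => Z (Fin.cons p.1 p.2) with hYdef
    have hY : Measurable Y := by
      have : Y = Z ∘ (MeasurableEquiv.piFinSuccAbove (fun _ : Fin (n + 1) => S) 0).symm := by
        ext p
        simp only [Function.comp, hcons, hYdef]
      rw [this]
      exact hZ.comp (MeasurableEquiv.measurable _)
    have hYM : ∀ p, |Y p| ≤ M := fun p => hM _
    have integral_eq : ∀ h : ℝ → ℝ, ∫ x, h (Z x) ∂(Measure.pi fun _ => μ) = ∫ p, h (Y p) ∂(μ.prod π) := by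
      intro h
      rw [← hmp.integral_comp' (fun x => h (Z x))]
      simp only [hcons, hYdef]
    -- Averaging out the first coordinate keeps the bound, the differences and the mean, so the
    -- induction hypothesis applies to `W`.
    set W : (Fin n → S) → ℝ := fun x => ∫ a, Y (a, x) ∂μ with hWdef
    have hYi : Integrable Y (μ.prod π) :=
      Integrable.of_bound hY.aestronglyMeasurable M (ae_of_all _ hYM)
    have hW : Measurable W := (hY.stronglyMeasurable.integral_prod_left').measurable
    have hYa : ∀ x, Integrable (fun a => Y (a, x)) μ := fun x =>
      Integrable.of_bound (hY.comp (by fun_prop)).aestronglyMeasurable M (ae_of_all _ fun a => hYM _)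
    have hWM : ∀ x, |W x| ≤ M := fun x => by
      have := norm_integral_le_of_norm_le_const (μ := μ) (C := M)
        (f := fun a => Y (a, x)) (ae_of_all _ fun a => hYM (a, x))
      simpa using this
    have hWd : ∀ x i y, |W (Function.update x i y) - W x| ≤ c := fun x i y => by
      rw [hWdef]
      simp only
      rw [← integral_sub (hYa _) (hYa _)]
      have := norm_integral_le_of_norm_le_const (μ := μ) (C := c)
        (f := fun a => Y (a, Function.update x i y) - Y (a, x)) (ae_of_all _ fun a => by
          simp only [hYdef, Fin.cons_update]
          exact hd _ _ _)
      simpa using this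
    have hEW : ∫ x, W x ∂π = ∫ p, Y p ∂(μ.prod π) := (integral_prod_symm Y hYi).symm
    set m := ∫ p, Y p ∂(μ.prod π) with hm
    have hm' : ∫ y, Z y ∂(Measure.pi fun _ => μ) = m := integral_eq id
    rw [hm', integral_eq (fun z => Real.exp (t * (z - m)))]
    have hExpM : Measurable fun p => Real.exp (t * (Y p - m)) := by fun_prop
    have hExpi : Integrable (fun p => Real.exp (t * (Y p - m))) (μ.prod π) := by
      refine Integrable.of_bound hExpM.aestronglyMeasurable (Real.exp (|t| * (M + |m|)))
        (ae_of_all _ fun p => ?_)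
      rw [Real.norm_eq_abs, Real.abs_exp]
      refine Real.exp_le_exp.2 ((le_abs_self _).trans ?_)
      rw [abs_mul]
      exact mul_le_mul_of_nonneg_left ((abs_sub _ _).trans (by linarith [hYM p])) (abs_nonneg _)
    have hExpWi : Integrable (fun x => Real.exp (t * (W x - m))) π := by
      refine Integrable.of_bound (by fun_prop) (Real.exp (|t| * (M + |m|)))
        (ae_of_all _ fun p => ?_)
      rw [Real.norm_eq_abs, Real.abs_exp]
      refine Real.exp_le_exp.2 ((le_abs_self _).trans ?_)
      rw [abs_mul]
      exact mul_le_mul_of_nonneg_left ((abs_sub _ _).trans (by linarith [hWM p])) (abs_nonneg _)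
    rw [integral_prod_symm _ hExpi]
    have hinner : ∀ x, ∫ a, Real.exp (t * (Y (a, x) - m)) ∂μ ≤
        Real.exp ((c / 2) ^ 2 * t ^ 2 / 2) * Real.exp (t * (W x - m)) := by
      intro x
      have hbdd : BddBelow (Set.range fun a => Y (a, x)) :=
        ⟨-M, by rintro _ ⟨a, rfl⟩; exact (abs_le.1 (hYM (a, x))).1⟩
      have hne : Nonempty S := nonempty_of_isProbabilityMeasure μ
      -- With the other coordinates fixed, the values fill an interval of length at most `c`;
      -- Hoeffding's lemma then gives variance proxy `(c / 2) ^ 2`.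
      have hIcc : ∀ a, Y (a, x) ∈ Set.Icc (⨅ a, Y (a, x)) ((⨅ a, Y (a, x)) + c) := by
        intro a
        refine ⟨ciInf_le hbdd a, ?_⟩
        rw [← sub_le_iff_le_add]
        refine le_ciInf fun b => ?_
        have := hd (Fin.cons b x) 0 a
        rw [Fin.update_cons_zero] at this
        have := (abs_le.1 this).2
        simp only [hYdef]
        linarith
      have hsub := (hasSubgaussianMGF_of_mem_Icc (μ := μ) (X := fun a => Y (a, x))
        (hY.comp (by fun_prop)).aemeasurable (ae_of_all _ hIcc)).mgf_le t
      simp only [mgf, add_sub_cancel_left, NNReal.coe_pow, NNReal.coe_div, coe_nnnorm,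
        Real.norm_eq_abs, abs_of_nonneg hc, NNReal.coe_ofNat] at hsub
      calc ∫ a, Real.exp (t * (Y (a, x) - m)) ∂μ
          = ∫ a, Real.exp (t * (Y (a, x) - W x)) * Real.exp (t * (W x - m)) ∂μ := by
            congr 1
            ext a
            rw [← Real.exp_add]
            ring_nf
        _ = (∫ a, Real.exp (t * (Y (a, x) - W x)) ∂μ) * Real.exp (t * (W x - m)) :=
            integral_mul_const _ _
        _ ≤ _ := mul_le_mul_of_nonneg_right hsub (Real.exp_pos _).le
    calc ∫ x, ∫ a, Real.exp (t * (Y (a, x) - m)) ∂μ ∂π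
        ≤ ∫ x, Real.exp ((c / 2) ^ 2 * t ^ 2 / 2) * Real.exp (t * (W x - m)) ∂π :=
          integral_mono hExpi.integral_prod_right (hExpWi.const_mul _) hinner
      _ = Real.exp ((c / 2) ^ 2 * t ^ 2 / 2) * ∫ x, Real.exp (t * (W x - m)) ∂π :=
          integral_const_mul _ _
      _ ≤ Real.exp ((c / 2) ^ 2 * t ^ 2 / 2) * Real.exp (n * (c / 2) ^ 2 * t ^ 2 / 2) := by
          refine mul_le_mul_of_nonneg_left ?_ (Real.exp_pos _).le
          have := ih W hW ⟨M, hWM⟩ hWd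
          rwa [hEW] at this
      _ = _ := by
          rw [← Real.exp_add]
          push_cast
          ring_nf

/-- McDiarmid's inequality for a function on an `n`-fold product whose coordinates change it by
at most `1 / n`. -/
theorem measure_ge_le_of_boundedDiff {S : Type*} [MeasurableSpace S] (μ : Measure S)
    [IsProbabilityMeasure μ] {n : ℕ} (hn : 1 ≤ n) (Z : (Fin n → S) → ℝ) (hZ : Measurable Z)
    {M : ℝ} (hM : ∀ x, |Z x| ≤ M)
    (hd : ∀ x i y, |Z (Function.update x i y) - Z x| ≤ 1 / n) {s : ℝ} (hs : 0 ≤ s) :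
    (Measure.pi fun _ : Fin n => μ).real
        {x | s ≤ Z x - ∫ y, Z y ∂(Measure.pi fun _ => μ)} ≤ Real.exp (-2 * n * s ^ 2) := by
  have hn0 : (0 : ℝ) < n := by exact_mod_cast hn
  set m := ∫ y, Z y ∂(Measure.pi fun _ => μ)
  -- The parameter `t = 4 n s` minimizes the Chernoff exponent `-t s + t ^ 2 / (8 n)`, with value
  -- `-2 n s ^ 2`.
  have hi : Integrable (fun x => Real.exp (4 * n * s * (Z x - m))) (Measure.pi fun _ => μ) := by
    refine Integrable.of_bound (by fun_prop) (Real.exp (|4 * n * s| * (M + |m|)))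
      (ae_of_all _ fun p => ?_)
    rw [Real.norm_eq_abs, Real.abs_exp]
    refine Real.exp_le_exp.2 ((le_abs_self _).trans ?_)
    rw [abs_mul]
    exact mul_le_mul_of_nonneg_left ((abs_sub _ _).trans (by linarith [hM p])) (abs_nonneg _)
  calc _ ≤ Real.exp (-(4 * n * s) * s) * mgf (fun x => Z x - m) (Measure.pi fun _ => μ) (4 * n * s) :=
        measure_ge_le_exp_mul_mgf s (by positivity) hi
    _ ≤ Real.exp (-(4 * n * s) * s) * Real.exp (n * (1 / n / 2) ^ 2 * (4 * n * s) ^ 2 / 2) :=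
        mul_le_mul_of_nonneg_left
          (integral_exp_le_of_boundedDiff μ (by positivity) (4 * n * s) n Z hZ ⟨M, hM⟩ hd)
          (Real.exp_pos _).le
    _ = _ := by
        rw [← Real.exp_add]
        congr 1
        field_simp
        ring


/-! ### The dyadic tree and the number of its leaves -/

/-- The interval `[α_{j,k}, α_{j,k+1})` of a node. -/
def nodeInterval (ε : ℝ) (p : ℕ × ℕ) : Set ℝ :=
  Set.Ico (dyadicLevel ε p.1 p.2) (dyadicLevel ε p.1 (p.2 + 1))

theorem dyadicLevel_succ_two_mul (ε : ℝ) (j k : ℕ) :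
    dyadicLevel ε (j + 1) (2 * k) = dyadicLevel ε j k := by
  simp only [dyadicLevel, pow_succ]
  push_cast
  field_simp

theorem dyadicLevel_lt_succ {ε : ℝ} (hε : ε < 1) (j k : ℕ) :
    dyadicLevel ε j k < dyadicLevel ε j (k + 1) := by
  have : 0 < 1 - ε := by linarith
  simp only [dyadicLevel]
  push_cast
  gcongr
  linarith

theorem dyadicLevel_nonneg {ε : ℝ} (hε : ε < 1) (j k : ℕ) : 0 ≤ dyadicLevel ε j k := by
  have : 0 < 1 - ε := by linarith
  simp only [dyadicLevel]
  positivity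

theorem dyadicLevel_le {ε : ℝ} (hε : ε < 1) {j k : ℕ} (hk : k ≤ 2 ^ j) :
    dyadicLevel ε j k ≤ 1 - ε := by
  have : 0 < 1 - ε := by linarith
  have hk' : (k : ℝ) ≤ 2 ^ j := by exact_mod_cast hk
  rw [dyadicLevel, div_le_iff₀ (by positivity), mul_comm]
  gcongr

theorem dyadicLevel_succ_sub (ε : ℝ) (j k : ℕ) :
    dyadicLevel ε j (k + 1) - dyadicLevel ε j k = (1 - ε) / 2 ^ j := by
  simp only [dyadicLevel]
  push_cast
  ring

theorem nodeInterval_nonempty {ε : ℝ} (hε : ε < 1) (p : ℕ × ℕ) : (nodeInterval ε p).Nonempty :=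
  Set.nonempty_Ico.2 (dyadicLevel_lt_succ hε _ _)

theorem nodeInterval_eq_union {ε : ℝ} (hε : ε < 1) (j k : ℕ) :
    nodeInterval ε (j, k) = nodeInterval ε (j + 1, 2 * k) ∪ nodeInterval ε (j + 1, 2 * k + 1) := by
  have h1 := dyadicLevel_lt_succ hε (j + 1) (2 * k)
  have h2 := dyadicLevel_lt_succ hε (j + 1) (2 * k + 1)
  have h3 := dyadicLevel_succ_two_mul ε j (k + 1)
  rw [mul_add, mul_one] at h3
  simp only [nodeInterval]
  rw [Set.Ico_union_Ico_eq_Ico h1.le h2.le, dyadicLevel_succ_two_mul, ← h3]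

theorem disjoint_nodeInterval_children (ε : ℝ) (j k : ℕ) :
    Disjoint (nodeInterval ε (j + 1, 2 * k)) (nodeInterval ε (j + 1, 2 * k + 1)) := by
  simp only [nodeInterval]
  rw [Set.Ico_disjoint_Ico]
  exact (min_le_left _ _).trans (le_max_right _ _)

theorem nodeInterval_subset_of_mem_leavesBelow (vol : ℝ → ℝ) {ε : ℝ} (hε : ε < 1) (τ : ℝ) :
    ∀ (m j k : ℕ) (p : ℕ × ℕ), p ∈ leavesBelow vol ε τ m j k →
      nodeInterval ε p ⊆ nodeInterval ε (j, k)
  | 0, j, k, p, hp => by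
    rw [leavesBelow, Finset.mem_singleton] at hp
    rw [hp]
  | m + 1, j, k, p, hp => by
    rw [leavesBelow] at hp
    split_ifs at hp with h
    · rw [nodeInterval_eq_union hε j k]
      rcases Finset.mem_union.1 hp with hp | hp
      · exact (nodeInterval_subset_of_mem_leavesBelow vol hε τ m _ _ p hp).trans
          Set.subset_union_left
      · exact (nodeInterval_subset_of_mem_leavesBelow vol hε τ m _ _ p hp).trans
          Set.subset_union_right
    · rw [Finset.mem_singleton] at hp
      rw [hp]

/-- A common leaf would have a nonempty interval inside two disjoint intervals. This lets sums over
leaves split along the children. -/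
theorem disjoint_leavesBelow_children (vol : ℝ → ℝ) {ε : ℝ} (hε : ε < 1) (τ : ℝ) (m j k : ℕ) :
    Disjoint (leavesBelow vol ε τ m (j + 1) (2 * k))
      (leavesBelow vol ε τ m (j + 1) (2 * k + 1)) := by
  rw [Finset.disjoint_left]
  intro p h1 h2
  obtain ⟨x, hx⟩ := nodeInterval_nonempty hε p
  exact Set.disjoint_left.1 (disjoint_nodeInterval_children ε j k)
    (nodeInterval_subset_of_mem_leavesBelow vol hε τ _ _ _ p h1 hx)
    (nodeInterval_subset_of_mem_leavesBelow vol hε τ _ _ _ p h2 hx)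

theorem sum_leavesBelow_of_notMem (vol : ℝ → ℝ) {ε : ℝ} (hε : ε < 1) (τ : ℝ) (m j k : ℕ) {α : ℝ}
    (hα : α ∉ nodeInterval ε (j, k)) :
    ∑ p ∈ leavesBelow vol ε τ m j k,
      (nodeInterval ε p).indicator (fun _ => vol (dyadicLevel ε p.1 (p.2 + 1))) α = 0 :=
  Finset.sum_eq_zero fun p hp => Set.indicator_of_notMem
    (fun h => hα (nodeInterval_subset_of_mem_leavesBelow vol hε τ m j k p hp h)) _

/-- At a point of the interval of `(j,k)`, the piecewise constant function of the tree below `(j,k)`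
takes the value attached to the one leaf that contains the point. -/
theorem exists_leaf_sum_leavesBelow (vol : ℝ → ℝ) {ε : ℝ} (hε : ε < 1) (τ : ℝ) {α : ℝ} :
    ∀ m j k : ℕ, α ∈ nodeInterval ε (j, k) → ∃ p : ℕ × ℕ, α ∈ nodeInterval ε p ∧
      nodeInterval ε p ⊆ nodeInterval ε (j, k) ∧
      (p.1 = j + m ∨ vol (dyadicLevel ε p.1 (p.2 + 1)) - vol (dyadicLevel ε p.1 p.2) ≤ τ) ∧
      ∑ p ∈ leavesBelow vol ε τ m j k,
        (nodeInterval ε p).indicator (fun _ => vol (dyadicLevel ε p.1 (p.2 + 1))) α =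
        vol (dyadicLevel ε p.1 (p.2 + 1))
  | 0, j, k, hα => ⟨(j, k), hα, subset_rfl, Or.inl rfl, by simp [leavesBelow, hα]⟩
  | m + 1, j, k, hα => by
    rw [leavesBelow]
    split_ifs with h
    · rw [Finset.sum_union (disjoint_leavesBelow_children vol hε τ m j k)]
      have hα' := hα
      rw [nodeInterval_eq_union hε] at hα' ⊢
      rcases hα' with hα' | hα'
      · obtain ⟨p, h1, h2, h3, h4⟩ := exists_leaf_sum_leavesBelow vol hε τ m _ _ hα'
        refine ⟨p, h1, h2.trans Set.subset_union_left, h3.imp_left fun h => by omega, ?_⟩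
        rw [h4, sum_leavesBelow_of_notMem vol hε τ m _ _
          (Set.disjoint_left.1 (disjoint_nodeInterval_children ε j k) hα'), add_zero]
      · obtain ⟨p, h1, h2, h3, h4⟩ := exists_leaf_sum_leavesBelow vol hε τ m _ _ hα'
        refine ⟨p, h1, h2.trans Set.subset_union_right, h3.imp_left fun h => by omega, ?_⟩
        rw [h4, sum_leavesBelow_of_notMem vol hε τ m _ _
          (Set.disjoint_right.1 (disjoint_nodeInterval_children ε j k) hα'), zero_add]
    · exact ⟨(j, k), hα, subset_rfl, Or.inr (not_lt.1 h), by simp [hα]⟩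

/-- The number of nodes at depth `j` with `a ≤ k < b` that satisfy the splitting rule. -/
noncomputable def splitCount (vol : ℝ → ℝ) (ε τ : ℝ) (j a b : ℕ) : ℕ :=
  ((Finset.Ico a b).filter fun l =>
    τ < vol (dyadicLevel ε j (l + 1)) - vol (dyadicLevel ε j l)).card

theorem splitCount_add (vol : ℝ → ℝ) (ε τ : ℝ) (j : ℕ) {a b c : ℕ} (hab : a ≤ b) (hbc : b ≤ c) :
    splitCount vol ε τ j a c = splitCount vol ε τ j a b + splitCount vol ε τ j b c := by
  rw [splitCount, splitCount, splitCount, ← Finset.Ico_union_Ico_eq_Ico hab hbc,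
    Finset.filter_union, Finset.card_union_of_disjoint]
  exact Finset.disjoint_filter_filter (Finset.Ico_disjoint_Ico_consecutive a b c)

/-- A binary tree has one more leaf than internal nodes. The right side also counts nodes that pass
the test without being reached, which makes it additive over subtrees and monotone under weakening
of the test. -/
theorem card_leavesBelow_le (vol : ℝ → ℝ) (ε τ : ℝ) :
    ∀ m j k : ℕ, (leavesBelow vol ε τ m j k).card ≤
      1 + ∑ i ∈ Finset.range m, splitCount vol ε τ (j + i) (k * 2 ^ i) ((k + 1) * 2 ^ i)
  | 0, j, k => by simp [leavesBelow]
  | m + 1, j, k => by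
    rw [leavesBelow]
    split_ifs with h
    · refine (Finset.card_union_le _ _).trans ?_
      have h1 := card_leavesBelow_le vol ε τ m (j + 1) (2 * k)
      have h2 := card_leavesBelow_le vol ε τ m (j + 1) (2 * k + 1)
      have h0 : splitCount vol ε τ (j + 0) (k * 2 ^ 0) ((k + 1) * 2 ^ 0) = 1 := by
        simp [splitCount, Finset.filter_singleton, h]
      have hs : ∀ i ∈ Finset.range m,
          splitCount vol ε τ (j + (i + 1)) (k * 2 ^ (i + 1)) ((k + 1) * 2 ^ (i + 1)) =
          splitCount vol ε τ (j + 1 + i) (2 * k * 2 ^ i) ((2 * k + 1) * 2 ^ i) +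
          splitCount vol ε τ (j + 1 + i) ((2 * k + 1) * 2 ^ i) ((2 * k + 1 + 1) * 2 ^ i) := by
        intro i _
        rw [← splitCount_add _ _ _ _ (by gcongr; omega) (by gcongr; omega)]
        congr 1 <;> ring
      rw [Finset.sum_range_succ', h0, Finset.sum_congr rfl hs, Finset.sum_add_distrib]
      omega
    · simp

/-- The tree is a root, or its leaves are at most twice as many as its splitting nodes. -/
theorem card_adaptiveLeaves_le (vol : ℝ → ℝ) (ε τ : ℝ) (n : ℕ) :
    (adaptiveLeaves vol ε τ n).card = 1 ∨ (adaptiveLeaves vol ε τ n).card ≤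
      2 * ∑ j ∈ Finset.range (maxDepth n), splitCount vol ε τ j 0 (2 ^ j) := by
  have h := card_leavesBelow_le vol ε τ (maxDepth n) 0 0
  simp only [zero_add, zero_mul, one_mul] at h
  rw [adaptiveLeaves]
  by_cases hs : τ < vol (dyadicLevel ε 0 1) - vol (dyadicLevel ε 0 0)
  · right
    -- A splitting root is itself counted, so the additive `1` is absorbed by doubling.
    have h1 : splitCount vol ε τ 0 0 (2 ^ 0) = 1 := by
      simp [splitCount, Finset.filter_singleton, hs]
    have h2 : splitCount vol ε τ 0 0 (2 ^ 0) ≤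
        ∑ j ∈ Finset.range (maxDepth n), splitCount vol ε τ j 0 (2 ^ j) :=
      Finset.single_le_sum (f := fun j => splitCount vol ε τ j 0 (2 ^ j)) (fun _ _ => Nat.zero_le _)
        (Finset.mem_range.2 (Nat.succ_pos _))
    omega
  · left
    simp [maxDepth, leavesBelow, hs]


/-! ### Uniform deviations: symmetrization, measurability, concentration -/

/-- The largest difference over `𝒢` between the empirical masses of two samples. -/
noncomputable def empDiff {d n m : ℕ} (𝒢 : Set (Set (Space d))) (x : Fin n → Space d)
    (y : Fin m → Space d) : ℝ := ⨆ A : 𝒢, |empMass x A - empMass y A|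

/-- The largest deviation over `𝒢` of the empirical mass from the mass. -/
noncomputable def empDev {d n : ℕ} (F : Measure (Space d)) (𝒢 : Set (Set (Space d)))
    (x : Fin n → Space d) : ℝ := ⨆ A : 𝒢, |empMass x A - F.real A|

variable {d n : ℕ}

theorem empMass_nonneg (x : Fin n → Space d) (A : Set (Space d)) : 0 ≤ empMass x A :=
  mul_nonneg (by positivity) (Finset.sum_nonneg fun _ _ =>
    Set.indicator_nonneg (fun _ _ => zero_le_one) _)

theorem empMass_le_one (x : Fin n → Space d) (A : Set (Space d)) : empMass x A ≤ 1 := by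
  rw [empMass]
  have h : ∑ i, A.indicator (1 : Space d → ℝ) (x i) ≤ n := by
    calc ∑ i, A.indicator (1 : Space d → ℝ) (x i) ≤ ∑ _i : Fin n, (1 : ℝ) :=
          Finset.sum_le_sum fun i _ => Set.indicator_le_self' (fun _ _ => zero_le_one) _
      _ = n := by simp
  -- For `n = 0` the factor `1 / n` is `0`.
  rcases Nat.eq_zero_or_pos n with hn | hn
  · simp [hn]
  · have : (0 : ℝ) < n := by exact_mod_cast hn
    rw [one_div, inv_mul_le_iff₀ this]
    simpa using h

theorem measurable_empMass {A : Set (Space d)} (hA : MeasurableSet A) :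
    Measurable fun x : Fin n → Space d => empMass x A := by
  unfold empMass
  refine Measurable.const_mul (Finset.measurable_sum _ fun i _ => ?_) _
  exact (measurable_one.indicator hA).comp (measurable_pi_apply i)

theorem integral_empMass (F : Measure (Space d)) [IsProbabilityMeasure F] (hn : 1 ≤ n)
    {A : Set (Space d)} (hA : MeasurableSet A) :
    ∫ x : Fin n → Space d, empMass x A ∂(Measure.pi fun _ => F) = F.real A := by
  have hn0 : (0 : ℝ) < n := by exact_mod_cast hn
  have hi : Integrable (A.indicator (1 : Space d → ℝ)) F :=
    (integrable_const (1 : ℝ)).indicator hA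
  simp only [empMass]
  rw [integral_const_mul, integral_finsetSum]
  · have : ∀ i : Fin n, ∫ x : Fin n → Space d, A.indicator (1 : Space d → ℝ) (x i)
        ∂(Measure.pi fun _ => F) = F.real A := by
      intro i
      rw [integral_comp_eval (μ := fun _ : Fin n => F) hi.aestronglyMeasurable, integral_indicator_one hA]
    simp only [this, Finset.sum_const, Finset.card_univ, Fintype.card_fin, nsmul_eq_mul]
    field_simp
  · intro i _
    exact integrable_comp_eval (μ := fun _ : Fin n => F) hi

theorem bddAbove_range_of_le {ι : Sort*} {g : ι → ℝ} {M : ℝ} (h : ∀ i, g i ≤ M) :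
    BddAbove (Set.range g) := ⟨M, by rintro _ ⟨i, rfl⟩; exact h i⟩

theorem abs_sub_le_one_of_mem_unit {a b : ℝ} (ha : 0 ≤ a) (ha' : a ≤ 1) (hb : 0 ≤ b) (hb' : b ≤ 1) :
    |a - b| ≤ 1 := abs_le.2 ⟨by linarith, by linarith⟩

theorem abs_empMass_sub_empMass_le_one {m : ℕ} (x : Fin n → Space d) (y : Fin m → Space d)
    (A : Set (Space d)) : |empMass x A - empMass y A| ≤ 1 :=
  abs_sub_le_one_of_mem_unit (empMass_nonneg _ _) (empMass_le_one _ _) (empMass_nonneg _ _)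
    (empMass_le_one _ _)

theorem abs_empMass_sub_measureReal_le_one (F : Measure (Space d)) [IsProbabilityMeasure F]
    (x : Fin n → Space d) (A : Set (Space d)) : |empMass x A - F.real A| ≤ 1 :=
  abs_sub_le_one_of_mem_unit (empMass_nonneg _ _) (empMass_le_one _ _) measureReal_nonneg
    measureReal_le_one

theorem abs_empMass_sub_empMass_le_empDiff {m : ℕ} {𝒢 : Set (Set (Space d))} (x : Fin n → Space d)
    (y : Fin m → Space d) {A : Set (Space d)} (hA : A ∈ 𝒢) :
    |empMass x A - empMass y A| ≤ empDiff 𝒢 x y :=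
  le_ciSup (f := fun A : 𝒢 => |empMass x A - empMass y A|)
    (bddAbove_range_of_le fun A => abs_empMass_sub_empMass_le_one x y A) ⟨A, hA⟩

theorem abs_empMass_sub_le_empDev (F : Measure (Space d)) [IsProbabilityMeasure F]
    {𝒢 : Set (Set (Space d))} (x : Fin n → Space d) {A : Set (Space d)} (hA : A ∈ 𝒢) :
    |empMass x A - F.real A| ≤ empDev F 𝒢 x :=
  le_ciSup (f := fun A : 𝒢 => |empMass x A - F.real A|)
    (bddAbove_range_of_le fun A => abs_empMass_sub_measureReal_le_one F x A) ⟨A, hA⟩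

theorem empDiff_nonneg {m : ℕ} (𝒢 : Set (Set (Space d))) (x : Fin n → Space d)
    (y : Fin m → Space d) : 0 ≤ empDiff 𝒢 x y := Real.iSup_nonneg fun _ => abs_nonneg _

theorem empDiff_le_one {m : ℕ} (𝒢 : Set (Set (Space d))) (x : Fin n → Space d)
    (y : Fin m → Space d) : empDiff 𝒢 x y ≤ 1 :=
  Real.iSup_le (fun A => abs_empMass_sub_empMass_le_one x y A) zero_le_one

theorem empDev_nonneg (F : Measure (Space d)) (𝒢 : Set (Set (Space d))) (x : Fin n → Space d) :
    0 ≤ empDev F 𝒢 x := Real.iSup_nonneg fun _ => abs_nonneg _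

theorem empDev_le_one (F : Measure (Space d)) [IsProbabilityMeasure F] (𝒢 : Set (Set (Space d)))
    (x : Fin n → Space d) : empDev F 𝒢 x ≤ 1 :=
  Real.iSup_le (fun A => abs_empMass_sub_measureReal_le_one F x A) zero_le_one

theorem abs_sign_mul_indicator_le (s : ℤˣ) (A : Set (Space d)) (x : Space d) :
    |((s : ℤ) : ℝ) * A.indicator 1 x| ≤ 1 := by
  by_cases h : x ∈ A <;> rcases Int.units_eq_one_or s with rfl | rfl <;> simp [h]

theorem signedSum_le_one (e : Fin n → ℤˣ) (x : Fin n → Space d) (A : Set (Space d)) :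
    (1 / (n : ℝ)) * |∑ i, ((e i : ℤ) : ℝ) * A.indicator 1 (x i)| ≤ 1 := by
  have h : |∑ i, ((e i : ℤ) : ℝ) * A.indicator 1 (x i)| ≤ n := by
    refine (Finset.abs_sum_le_sum_abs _ _).trans ?_
    refine (Finset.sum_le_sum fun i _ => abs_sign_mul_indicator_le _ _ _).trans ?_
    simp
  rcases Nat.eq_zero_or_pos n with hn | hn
  · simp [hn]
  · have : (0 : ℝ) < n := by exact_mod_cast hn
    rw [one_div, inv_mul_le_iff₀ this]
    simpa using h

theorem signedSup_nonneg (𝒢 : Set (Set (Space d))) (e : Fin n → ℤˣ) (x : Fin n → Space d) :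
    0 ≤ signedSup 𝒢 n e x := Real.iSup_nonneg fun _ => by positivity

theorem signedSup_le_one (𝒢 : Set (Set (Space d))) (e : Fin n → ℤˣ) (x : Fin n → Space d) :
    signedSup 𝒢 n e x ≤ 1 := Real.iSup_le (fun A => signedSum_le_one e x A) zero_le_one

theorem le_signedSup {𝒢 : Set (Set (Space d))} (e : Fin n → ℤˣ) (x : Fin n → Space d)
    {A : Set (Space d)} (hA : A ∈ 𝒢) :
    (1 / (n : ℝ)) * |∑ i, ((e i : ℤ) : ℝ) * A.indicator 1 (x i)| ≤ signedSup 𝒢 n e x :=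
  le_ciSup (f := fun A : 𝒢 =>
      (1 / (n : ℝ)) * |∑ i, ((e i : ℤ) : ℝ) * (A : Set (Space d)).indicator 1 (x i)|)
    (bddAbove_range_of_le fun A => signedSum_le_one e x A) ⟨A, hA⟩

theorem integrable_signedSup (F : Measure (Space d)) [IsProbabilityMeasure F]
    {𝒢 : Set (Set (Space d))} (h𝒢 : IsSetClass 𝒢) (e : Fin n → ℤˣ) :
    Integrable (signedSup 𝒢 n e) (Measure.pi fun _ => F) :=
  Integrable.of_bound (h𝒢.measurable_signedSup n e).aestronglyMeasurable 1 (ae_of_all _ fun x => by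
    rw [Real.norm_eq_abs, abs_of_nonneg (signedSup_nonneg _ _ _)]
    exact signedSup_le_one _ _ _)

theorem rademacherAvg_nonneg (F : Measure (Space d)) (𝒢 : Set (Set (Space d))) (n : ℕ) :
    0 ≤ rademacherAvg F 𝒢 n :=
  mul_nonneg (by positivity) (Finset.sum_nonneg fun _ _ =>
    integral_nonneg fun _ => signedSup_nonneg _ _ _)

theorem rademacherAvg_le_one (F : Measure (Space d)) [IsProbabilityMeasure F]
    (𝒢 : Set (Set (Space d))) (n : ℕ) : rademacherAvg F 𝒢 n ≤ 1 := by
  have h : ∑ e : Fin n → ℤˣ, ∫ x, signedSup 𝒢 n e x ∂(Measure.pi fun _ => F) ≤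
      ∑ _e : Fin n → ℤˣ, (1 : ℝ) := by
    refine Finset.sum_le_sum fun e _ => ?_
    have := norm_integral_le_of_norm_le_const (μ := Measure.pi fun _ : Fin n => F) (C := 1)
      (f := signedSup 𝒢 n e) (ae_of_all _ fun x => by
        rw [Real.norm_eq_abs, abs_of_nonneg (signedSup_nonneg _ _ _)]
        exact signedSup_le_one _ _ _)
    simp only [probReal_univ, mul_one] at this
    exact (le_abs_self _).trans this
  simp only [Finset.sum_const, Finset.card_univ, Fintype.card_pi, Fintype.card_units_int,
    Finset.prod_const, Fintype.card_fin, nsmul_eq_mul, mul_one] at h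
  rw [rademacherAvg, one_div, inv_mul_le_iff₀ (by positivity)]
  simpa using h

/-- Reindexing frees the assumed measurability from the index type `Fin N`, so that points may be
repeated and two samples merged. -/
theorem measurable_iSup_abs_signedSum {𝒢 : Set (Set (Space d))} (h𝒢 : IsSetClass 𝒢) {ι : Type*}
    [Fintype ι] (e : ι → ℤˣ) :
    Measurable fun z : ι → Space d =>
      ⨆ A : 𝒢, |∑ i, ((e i : ℤ) : ℝ) * (A : Set (Space d)).indicator 1 (z i)| := by
  set σ := (Fintype.equivFin ι).symm
  set N := Fintype.card ι with hN
  have h : (fun z : ι → Space d =>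
      ⨆ A : 𝒢, |∑ i, ((e i : ℤ) : ℝ) * (A : Set (Space d)).indicator 1 (z i)|) =
      fun z => N * signedSup 𝒢 N (e ∘ σ) (z ∘ σ) := by
    ext z
    rw [signedSup, Real.mul_iSup_of_nonneg (Nat.cast_nonneg _)]
    congr 1
    ext A
    rw [← Equiv.sum_comp σ]
    rcases Nat.eq_zero_or_pos N with h0 | h0
    · have : IsEmpty ι := Fintype.card_eq_zero_iff.1 h0
      have : IsEmpty (Fin N) := σ.isEmpty
      simp only [Finset.univ_eq_empty, Finset.sum_empty, abs_zero, mul_zero]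
    · have : (0 : ℝ) < N := by exact_mod_cast h0
      rw [← mul_assoc, mul_one_div_cancel this.ne', one_mul]
      rfl
  rw [h]
  refine Measurable.const_mul ((h𝒢.measurable_signedSup N _).comp ?_) _
  exact measurable_pi_lambda _ fun i => measurable_pi_apply _

/-- Repeating each point of the first sample `k` times with sign `+1` and giving the `m = n k`
points of the second the sign `-1` turns the difference of empirical masses into `1 / m` times one
signed sum. -/
theorem measurable_empDiff {𝒢 : Set (Set (Space d))} (h𝒢 : IsSetClass 𝒢) {k m : ℕ} (hn : 1 ≤ n)
    (hk : 1 ≤ k) (hm : m = n * k) :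
    Measurable fun p : (Fin n → Space d) × (Fin m → Space d) => empDiff 𝒢 p.1 p.2 := by
  have hn0 : (0 : ℝ) < n := by exact_mod_cast hn
  have hk0 : (0 : ℝ) < k := by exact_mod_cast hk
  have hm0 : (m : ℝ) = n * k := by exact_mod_cast hm
  set e : (Fin n × Fin k) ⊕ Fin m → ℤˣ := Sum.elim (fun _ => 1) (fun _ => -1)
  set z : (Fin n → Space d) × (Fin m → Space d) → (Fin n × Fin k) ⊕ Fin m → Space d :=
    fun p => Sum.elim (fun i => p.1 i.1) p.2
  have hz : Measurable z := measurable_pi_lambda _ fun i => by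
    rcases i with i | i
    · exact (measurable_pi_apply i.1).comp measurable_fst
    · exact (measurable_pi_apply i).comp measurable_snd
  have h : (fun p : (Fin n → Space d) × (Fin m → Space d) => empDiff 𝒢 p.1 p.2) = fun p =>
      (1 / (m : ℝ)) *
        ⨆ A : 𝒢, |∑ i, ((e i : ℤ) : ℝ) * (A : Set (Space d)).indicator 1 (z p i)| := by
    ext p
    rw [empDiff, Real.mul_iSup_of_nonneg (by positivity)]
    congr 1
    ext A
    have : |1 / (m : ℝ)| = 1 / m := abs_of_nonneg (by positivity)
    rw [← this, ← abs_mul]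
    congr 1
    simp only [empMass, Fintype.sum_sum_type, e, z, Sum.elim_inl, Sum.elim_inr,
      Fintype.sum_prod_type, Units.val_one, Units.val_neg, Int.cast_one, Int.cast_neg, one_mul,
      neg_mul, Finset.sum_neg_distrib, Finset.sum_const, Finset.card_univ, Fintype.card_fin,
      nsmul_eq_mul, ← Finset.mul_sum]
    rw [hm0]
    field_simp
    ring
  rw [h]
  exact ((measurable_iSup_abs_signedSum h𝒢 e).comp hz).const_mul _

theorem measurable_empDiff_left {𝒢 : Set (Set (Space d))} (h𝒢 : IsSetClass 𝒢) {k m : ℕ}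
    (hn : 1 ≤ n) (hk : 1 ≤ k) (hm : m = n * k) (y : Fin m → Space d) :
    Measurable fun x : Fin n → Space d => empDiff 𝒢 x y :=
  (measurable_empDiff h𝒢 hn hk hm).of_uncurry_right

theorem integrable_empDiff (F : Measure (Space d)) [IsProbabilityMeasure F]
    {𝒢 : Set (Set (Space d))} (h𝒢 : IsSetClass 𝒢) (hn : 1 ≤ n) :
    Integrable (fun p : (Fin n → Space d) × (Fin n → Space d) => empDiff 𝒢 p.1 p.2)
      ((Measure.pi fun _ => F).prod (Measure.pi fun _ => F)) :=
  Integrable.of_bound (measurable_empDiff h𝒢 hn le_rfl (mul_one n).symm).aestronglyMeasurable 1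
    (ae_of_all _ fun p => by
      rw [Real.norm_eq_abs, abs_of_nonneg (empDiff_nonneg _ _ _)]
      exact empDiff_le_one _ _ _)

/-- Exchanging the two samples at the coordinates with sign `-1` bounds their difference by two
signed sums. -/
theorem empDiff_exchange_le {𝒢 : Set (Set (Space d))} [Nonempty 𝒢] (e : Fin n → ℤˣ)
    (w : Fin n → Space d × Space d) :
    empDiff 𝒢 (fun i => (if e i = 1 then w i else (w i).swap).1)
        (fun i => (if e i = 1 then w i else (w i).swap).2) ≤
      signedSup 𝒢 n e (fun i => (w i).1) + signedSup 𝒢 n e (fun i => (w i).2) := by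
  refine ciSup_le fun A => ?_
  refine le_trans ?_ (add_le_add (le_signedSup e _ A.2) (le_signedSup e _ A.2))
  have h : empMass (fun i => (if e i = 1 then w i else (w i).swap).1) (A : Set (Space d)) -
      empMass (fun i => (if e i = 1 then w i else (w i).swap).2) (A : Set (Space d)) =
      1 / (n : ℝ) * (∑ i, ((e i : ℤ) : ℝ) * (A : Set (Space d)).indicator 1 (w i).1 -
        ∑ i, ((e i : ℤ) : ℝ) * (A : Set (Space d)).indicator 1 (w i).2) := by
    rw [empMass, empMass, ← mul_sub, ← Finset.sum_sub_distrib, ← Finset.sum_sub_distrib]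
    congr 1
    refine Finset.sum_congr rfl fun i _ => ?_
    rcases Int.units_eq_one_or (e i) with h | h
    · simp [h]
    · simp [h, show (-1 : ℤˣ) ≠ 1 by decide]
      ring
  rw [h, abs_mul, abs_of_nonneg (by positivity : 0 ≤ 1 / (n : ℝ)), ← mul_add]
  exact mul_le_mul_of_nonneg_left (abs_sub _ _) (by positivity)

/-- For any fixed signs, exchanging the two samples at the coordinates of sign `-1` preserves the
law of the pair. Averaging over the signs is left to the next step. -/
theorem integral_empDiff_le_signedSup (F : Measure (Space d)) [IsProbabilityMeasure F]
    {𝒢 : Set (Set (Space d))} [Nonempty 𝒢] (h𝒢 : IsSetClass 𝒢) (hn : 1 ≤ n) (e : Fin n → ℤˣ) :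
    ∫ p : (Fin n → Space d) × (Fin n → Space d), empDiff 𝒢 p.1 p.2
        ∂((Measure.pi fun _ => F).prod (Measure.pi fun _ => F)) ≤
      2 * ∫ x, signedSup 𝒢 n e x ∂(Measure.pi fun _ => F) := by
  set π : Measure (Fin n → Space d) := Measure.pi fun _ => F
  have hΦ := measurePreserving_arrowProdEquivProdArrow (Space d) (Space d) (Fin n)
    (fun _ => F) (fun _ => F)
  have hswap : MeasurePreserving
      (fun (w : Fin n → Space d × Space d) i => if e i = 1 then w i else (w i).swap)
      (Measure.pi fun _ => F.prod F) (Measure.pi fun _ => F.prod F) := by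
    refine measurePreserving_pi _ _
      (f := fun i (z : Space d × Space d) => if e i = 1 then z else z.swap) fun i => ?_
    by_cases h : e i = 1
    · simp only [h, if_true]
      exact MeasurePreserving.id _
    · simp only [h, if_false]
      exact Measure.measurePreserving_swap
  have hcomp := (hΦ.comp hswap)
  have hD := integrable_empDiff F h𝒢 hn
  have h1 : Integrable (fun p : (Fin n → Space d) × (Fin n → Space d) => signedSup 𝒢 n e p.1)
      (π.prod π) := (integrable_signedSup F h𝒢 e).comp_fst π
  have h2 : Integrable (fun p : (Fin n → Space d) × (Fin n → Space d) => signedSup 𝒢 n e p.2)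
      (π.prod π) := (integrable_signedSup F h𝒢 e).comp_snd π
  have key : ∀ g : (Fin n → Space d) × (Fin n → Space d) → ℝ, Integrable g (π.prod π) →
      ∀ T, MeasurePreserving T (Measure.pi fun _ : Fin n => F.prod F) (π.prod π) →
      ∫ p, g p ∂(π.prod π) = ∫ w, g (T w) ∂(Measure.pi fun _ : Fin n => F.prod F) := by
    intro g hg T hT
    rw [← hT.map_eq, integral_map hT.measurable.aemeasurable]
    rw [hT.map_eq]
    exact hg.aestronglyMeasurable
  rw [key _ hD _ hcomp]
  calc _ ≤ ∫ w, (signedSup 𝒢 n e (fun i => (w i).1) + signedSup 𝒢 n e (fun i => (w i).2))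
        ∂(Measure.pi fun _ : Fin n => F.prod F) := by
        refine integral_mono (hcomp.integrable_comp_of_integrable hD)
          (hΦ.integrable_comp_of_integrable (h1.add h2)) fun w => ?_
        exact empDiff_exchange_le e w
    _ = ∫ p : (Fin n → Space d) × (Fin n → Space d),
          (signedSup 𝒢 n e p.1 + signedSup 𝒢 n e p.2) ∂(π.prod π) :=
        (key _ (h1.add h2) _ hΦ).symm
    _ = 2 * ∫ x, signedSup 𝒢 n e x ∂π := by
        rw [integral_add h1 h2, integral_fun_fst (signedSup 𝒢 n e),
          integral_fun_snd (signedSup 𝒢 n e)]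
        simp
        ring

/-- Symmetrization with a ghost sample. -/
theorem integral_empDiff_le (F : Measure (Space d)) [IsProbabilityMeasure F]
    {𝒢 : Set (Set (Space d))} [Nonempty 𝒢] (h𝒢 : IsSetClass 𝒢) (hn : 1 ≤ n) :
    ∫ p : (Fin n → Space d) × (Fin n → Space d), empDiff 𝒢 p.1 p.2
        ∂((Measure.pi fun _ => F).prod (Measure.pi fun _ => F)) ≤ 2 * rademacherAvg F 𝒢 n := by
  have h := Finset.sum_le_sum fun (e : Fin n → ℤˣ) (_ : e ∈ Finset.univ) =>
    integral_empDiff_le_signedSup F h𝒢 hn e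
  simp only [Finset.sum_const, Finset.card_univ, Fintype.card_pi, Fintype.card_units_int,
    Finset.prod_const, Fintype.card_fin, nsmul_eq_mul, ← Finset.mul_sum] at h
  rw [rademacherAvg, one_div, ← mul_assoc, mul_comm (2 : ℝ), mul_assoc, ← div_eq_inv_mul,
    le_div_iff₀ (by positivity), mul_comm]
  simpa using h

/-- The deviation of a sample is at most its expected difference from a ghost sample. -/
theorem empDev_le_integral_empDiff (F : Measure (Space d)) [IsProbabilityMeasure F]
    {𝒢 : Set (Set (Space d))} [Nonempty 𝒢] (h𝒢 : IsSetClass 𝒢) (hn : 1 ≤ n) (x : Fin n → Space d) :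
    empDev F 𝒢 x ≤ ∫ y : Fin n → Space d, empDiff 𝒢 x y ∂(Measure.pi fun _ => F) := by
  refine ciSup_le fun A => ?_
  have hA := h𝒢.measurableSet A A.2
  have hi : Integrable (fun y : Fin n → Space d => empMass y (A : Set (Space d)))
      (Measure.pi fun _ => F) :=
    Integrable.of_bound (measurable_empMass hA).aestronglyMeasurable 1 (ae_of_all _ fun y => by
      rw [Real.norm_eq_abs, abs_of_nonneg (empMass_nonneg _ _)]
      exact empMass_le_one _ _)
  have hDi : Integrable (fun y : Fin n → Space d => empDiff 𝒢 x y) (Measure.pi fun _ => F) :=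
    Integrable.of_bound ((measurable_empDiff h𝒢 hn le_rfl (mul_one n).symm).comp
      (measurable_const.prodMk measurable_id)).aestronglyMeasurable 1
      (ae_of_all _ fun p => by
        rw [Real.norm_eq_abs, abs_of_nonneg (empDiff_nonneg _ _ _)]
        exact empDiff_le_one _ _ _)
  have h : empMass x (A : Set (Space d)) - F.real A =
      ∫ y : Fin n → Space d, (empMass x A - empMass y A) ∂(Measure.pi fun _ => F) := by
    rw [integral_sub (integrable_const _) hi, integral_empMass F hn hA]
    simp
  rw [h]
  refine abs_integral_le_integral_abs.trans (integral_mono ((integrable_const _).sub hi).abs hDi ?_)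
  exact fun y => abs_empMass_sub_empMass_le_empDiff x y A.2

/-- Some sample does no worse than the average. The average taken is that of the integrated
difference, since `empDev` is not yet known to be measurable. -/
theorem exists_empDev_le (F : Measure (Space d)) [IsProbabilityMeasure F]
    {𝒢 : Set (Set (Space d))} [Nonempty 𝒢] (h𝒢 : IsSetClass 𝒢) (hn : 1 ≤ n) :
    ∃ y : Fin n → Space d, empDev F 𝒢 y ≤ 2 * rademacherAvg F 𝒢 n := by
  have hD := integrable_empDiff F h𝒢 hn
  obtain ⟨y, hy⟩ := exists_le_integral hD.integral_prod_left
  refine ⟨y, (empDev_le_integral_empDiff F h𝒢 hn y).trans (hy.trans ?_)⟩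
  rw [← integral_prod _ hD]
  exact integral_empDiff_le F h𝒢 hn

/-- By the triangle inequality, replacing `F` by the empirical measure of `y` shifts each deviation
by at most `empDev F 𝒢 y`. -/
theorem abs_empDiff_sub_empDev_le (F : Measure (Space d)) [IsProbabilityMeasure F]
    {𝒢 : Set (Set (Space d))} [Nonempty 𝒢] {m : ℕ} (x : Fin n → Space d) (y : Fin m → Space d) :
    |empDiff 𝒢 x y - empDev F 𝒢 x| ≤ empDev F 𝒢 y := by
  rw [abs_sub_le_iff]
  constructor
  · rw [sub_le_iff_le_add]
    refine ciSup_le fun A => ?_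
    have h1 := abs_empMass_sub_le_empDev F x A.2
    have h2 := abs_empMass_sub_le_empDev F y A.2
    have h3 := abs_sub_le (empMass x (A : Set (Space d))) (F.real A) (empMass y A)
    rw [abs_sub_comm (F.real _)] at h3
    linarith
  · rw [sub_le_iff_le_add]
    refine ciSup_le fun A => ?_
    have h1 := abs_empMass_sub_empMass_le_empDiff x y A.2
    have h2 := abs_empMass_sub_le_empDev F y A.2
    have h3 := abs_sub_le (empMass x (A : Set (Space d))) (empMass y A) (F.real A)
    linarith

/-- The deviation is a uniform limit of differences from fixed samples. -/
theorem measurable_empDev (F : Measure (Space d)) [IsProbabilityMeasure F]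
    {𝒢 : Set (Set (Space d))} [Nonempty 𝒢] (h𝒢 : IsSetClass 𝒢) (hn : 1 ≤ n)
    (hR : ∃ c > 0, ∀ m : ℕ, 1 ≤ m → rademacherAvg F 𝒢 m ≤ c / Real.sqrt m) :
    Measurable fun x : Fin n → Space d => empDev F 𝒢 x := by
  obtain ⟨c, hc, hR⟩ := hR
  -- Reference samples have size a positive multiple of `n`, as `measurable_empDiff` requires; their
  -- deviations tend to `0` by the assumption on the Rademacher averages.
  have hpos : ∀ k : ℕ, 1 ≤ n * (k + 1) := fun k => Nat.mul_pos hn (Nat.succ_pos k)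
  have hex : ∀ k : ℕ, ∃ y : Fin (n * (k + 1)) → Space d,
      empDev F 𝒢 y ≤ 2 * rademacherAvg F 𝒢 (n * (k + 1)) := fun k => exists_empDev_le F h𝒢 (hpos k)
  choose y hy using hex
  have hmeas : ∀ k : ℕ, Measurable fun x : Fin n → Space d => empDiff 𝒢 x (y k) := fun k =>
    measurable_empDiff_left (k := k + 1) h𝒢 hn (Nat.le_add_left 1 k) rfl (y k)
  refine measurable_of_tendsto_metrizable hmeas (tendsto_pi_nhds.2 fun x => ?_)
  have hlim : Filter.Tendsto (fun k : ℕ => 2 * (c / Real.sqrt ((k + 1 : ℕ) : ℝ))) Filter.atTop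
      (nhds 0) := by
    have h1 : Filter.Tendsto (fun k : ℕ => Real.sqrt ((k + 1 : ℕ) : ℝ)) Filter.atTop Filter.atTop :=
      Real.tendsto_sqrt_atTop.comp (tendsto_natCast_atTop_atTop.comp (Filter.tendsto_add_atTop_nat 1))
    simpa using (h1.const_div_atTop c).const_mul 2
  rw [tendsto_iff_dist_tendsto_zero]
  refine squeeze_zero (fun _ => dist_nonneg) (fun k => ?_) hlim
  rw [Real.dist_eq]
  refine (abs_empDiff_sub_empDev_le F x (y k)).trans ((hy k).trans ?_)
  refine mul_le_mul_of_nonneg_left ((hR _ (hpos k)).trans ?_) zero_le_two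
  have : (0 : ℝ) < ((k + 1 : ℕ) : ℝ) := by positivity
  gcongr
  exact Nat.le_mul_of_pos_left _ hn

theorem integral_empDev_le (F : Measure (Space d)) [IsProbabilityMeasure F]
    {𝒢 : Set (Set (Space d))} [Nonempty 𝒢] (h𝒢 : IsSetClass 𝒢) (hn : 1 ≤ n) :
    ∫ x : Fin n → Space d, empDev F 𝒢 x ∂(Measure.pi fun _ => F) ≤ 2 * rademacherAvg F 𝒢 n := by
  have hD := integrable_empDiff F h𝒢 hn
  refine le_trans ?_ (integral_empDiff_le F h𝒢 hn)
  rw [integral_prod _ hD]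
  exact integral_mono_of_nonneg (ae_of_all _ fun x => empDev_nonneg _ _ _) hD.integral_prod_left
    (ae_of_all _ fun x => empDev_le_integral_empDiff F h𝒢 hn x)

theorem abs_empMass_update_sub_le (x : Fin n → Space d) (i : Fin n) (y : Space d)
    (A : Set (Space d)) : |empMass (Function.update x i y) A - empMass x A| ≤ 1 / n := by
  rw [empMass, empMass, ← mul_sub, ← Finset.sum_sub_distrib, Finset.sum_eq_single i, abs_mul,
    abs_of_nonneg (by positivity : 0 ≤ 1 / (n : ℝ))]
  · refine mul_le_of_le_one_right (by positivity) ?_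
    simp only [Function.update_self]
    by_cases h1 : y ∈ A <;> by_cases h2 : x i ∈ A <;> simp [h1, h2]
  · intro j _ hj
    simp [Function.update_of_ne hj]
  · simp

theorem abs_empDev_update_sub_le (F : Measure (Space d)) [IsProbabilityMeasure F]
    {𝒢 : Set (Set (Space d))} [Nonempty 𝒢] (x : Fin n → Space d) (i : Fin n) (y : Space d) :
    |empDev F 𝒢 (Function.update x i y) - empDev F 𝒢 x| ≤ 1 / n := by
  rw [abs_sub_le_iff]
  constructor <;>
  · rw [sub_le_iff_le_add]
    refine ciSup_le fun A => ?_
    have h0 := abs_empMass_update_sub_le x i y (A : Set (Space d))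
    have h1 := abs_empMass_sub_le_empDev F x A.2
    have h2 := abs_empMass_sub_le_empDev F (Function.update x i y) A.2
    rw [abs_le] at *
    constructor <;> linarith

/-- The deviation inequality: with probability at least `1 - δ`, the empirical mass is within the
penalty of the mass, uniformly over the class. -/
theorem one_sub_le_measure_empDev_le (F : Measure (Space d)) [IsProbabilityMeasure F]
    {𝒢 : Set (Set (Space d))} [Nonempty 𝒢] (h𝒢 : IsSetClass 𝒢) (hn : 1 ≤ n)
    (hR : ∃ c > 0, ∀ m : ℕ, 1 ≤ m → rademacherAvg F 𝒢 m ≤ c / Real.sqrt m) {δ : ℝ}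
    (hδ : δ ∈ Set.Ioo (0 : ℝ) 1) :
    1 - δ ≤ (Measure.pi fun _ : Fin n => F).real {x | empDev F 𝒢 x ≤ penalty F 𝒢 n δ} := by
  have hn0 : (0 : ℝ) < n := by exact_mod_cast hn
  have hZ := measurable_empDev F h𝒢 hn hR
  set s := Real.sqrt (Real.log (1 / δ) / (2 * n)) with hs
  have hlog : 0 ≤ Real.log (1 / δ) := Real.log_nonneg (by
    rw [le_div_iff₀ hδ.1]; linarith [hδ.2])
  have h := measure_ge_le_of_boundedDiff F hn (fun x => empDev F 𝒢 x) hZ (M := 1)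
    (fun x => by
      rw [abs_of_nonneg (empDev_nonneg _ _ _)]
      exact empDev_le_one _ _ _)
    (abs_empDev_update_sub_le F) (Real.sqrt_nonneg _ : 0 ≤ s)
  -- The second term of the penalty is the `s` for which McDiarmid's tail equals `δ`.
  have hexp : Real.exp (-2 * n * s ^ 2) = δ := by
    rw [hs, Real.sq_sqrt (by positivity)]
    have : -2 * n * (Real.log (1 / δ) / (2 * n)) = Real.log δ := by
      rw [one_div, Real.log_inv]
      field_simp
    rw [this, Real.exp_log hδ.1]
  rw [hexp] at h
  have hmeas : MeasurableSet {x : Fin n → Space d | empDev F 𝒢 x ≤ penalty F 𝒢 n δ} :=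
    measurableSet_le hZ measurable_const
  -- Since the mean is at most `2 R_n`, exceeding the penalty means exceeding the mean by `s`.
  have hc : (Measure.pi fun _ : Fin n => F).real
      {x : Fin n → Space d | empDev F 𝒢 x ≤ penalty F 𝒢 n δ}ᶜ ≤ δ := by
    refine le_trans (measureReal_mono ?_) h
    intro x hx
    simp only [Set.mem_compl_iff, Set.mem_ofPred_eq, not_le, penalty] at hx ⊢
    have := integral_empDev_le F h𝒢 hn
    linarith
  rw [probReal_compl_eq_one_sub hmeas] at hc
  linarith

end MassVolume

namespace MassVolume

/-! ### Level sets of the density and the optimal curve -/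

variable {d : ℕ} {f : Space d → ℝ}

theorem isProbabilityMeasure_law (hf : IsProbDensity f) : IsProbabilityMeasure (law f) :=
  ⟨by rw [law, withDensity_apply _ MeasurableSet.univ, Measure.restrict_univ, hf.lintegral_eq_one]⟩

theorem ofReal_mul_volume_le_law (hf : IsProbDensity f) {t : ℝ} {A : Set (Space d)}
    (hA : MeasurableSet A) (h : ∀ x ∈ A, t ≤ f x) : ENNReal.ofReal t * volume A ≤ law f A := by
  rw [law, withDensity_apply _ hA, ← setLIntegral_const]
  exact setLIntegral_mono hf.measurable.ennreal_ofReal fun x hx => ENNReal.ofReal_le_ofReal (h x hx)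

theorem law_le_ofReal_mul_volume {t : ℝ} {A : Set (Space d)}
    (hA : MeasurableSet A) (h : ∀ x ∈ A, f x ≤ t) : law f A ≤ ENNReal.ofReal t * volume A := by
  rw [law, withDensity_apply _ hA, ← setLIntegral_const]
  exact setLIntegral_mono measurable_const fun x hx => ENNReal.ofReal_le_ofReal (h x hx)

theorem measurableSet_level (hf : IsProbDensity f) (t : ℝ) : MeasurableSet {x | t ≤ f x} :=
  measurableSet_le measurable_const hf.measurable

theorem volume_level_lt_top (hf : IsProbDensity f) {t : ℝ} (ht : 0 < t) :
    volume {x | t ≤ f x} < ⊤ := by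
  have := isProbabilityMeasure_law hf
  have h := ofReal_mul_volume_le_law hf (measurableSet_level hf t) fun x hx => hx
  have h1 : ENNReal.ofReal t * volume {x | t ≤ f x} < ⊤ :=
    h.trans_lt (measure_lt_top _ _)
  exact ENNReal.lt_top_of_mul_ne_top_right h1.ne (by simpa using ht)

theorem law_nonpos_eq_zero (hf : IsProbDensity f) : law f {x | f x ≤ 0} = 0 := by
  have h := law_le_ofReal_mul_volume (f := f) (t := 0) (A := {x | f x ≤ 0})
    (measurableSet_le hf.measurable measurable_const) fun x hx => hx
  simpa using h

/-- Levels `t ≤ 0` carry no mass for any density, so no positivity of `t` is needed. -/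
theorem law_fiber_eq_zero (hf : IsProbDensity f) (hflat : NoFlatParts f) (t : ℝ) :
    law f {x | f x = t} = 0 := by
  rcases lt_or_ge 0 t with ht | ht
  · exact hflat t ht
  · exact measure_mono_null (fun x (hx : f x = t) => (hx.le.trans ht : f x ≤ 0))
      (law_nonpos_eq_zero hf)

theorem law_level_le_iff (hf : IsProbDensity f) (hflat : NoFlatParts f) (t α : ℝ) :
    (law f).real {x | t ≤ f x} ≤ α ↔ 1 - α ≤ (law f).real {x | f x ≤ t} := by
  have := isProbabilityMeasure_law hf
  have h1 : (law f).real {x | t ≤ f x} = (law f).real {x | t < f x} := by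
    refine measureReal_congr ?_
    have h : ∀ᵐ x ∂(law f), f x ≠ t := by
      rw [ae_iff]
      simpa using law_fiber_eq_zero hf hflat t
    filter_upwards [h] with x hx
    exact propext ⟨fun h : t ≤ f x => lt_of_le_of_ne h (Ne.symm hx), fun h : t < f x => h.le⟩
  have h2 : {x | t < f x} = {x | f x ≤ t}ᶜ := by
    ext x
    simp
  rw [h1, h2, probReal_compl_eq_one_sub (measurableSet_le hf.measurable measurable_const)]
  constructor <;> intro h <;> linarith

theorem quantileStar_eq_massInv (hf : IsProbDensity f) (hflat : NoFlatParts f) (α : ℝ) :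
    quantileStar f α = massInv (law f) f α := by
  rw [quantileStar, quantile, massInv]
  congr 1
  ext t
  exact (law_level_le_iff hf hflat t α).symm

theorem law_level_anti (hf : IsProbDensity f) {s t : ℝ} (h : s ≤ t) :
    (law f).real {x | t ≤ f x} ≤ (law f).real {x | s ≤ f x} := by
  have := isProbabilityMeasure_law hf
  exact measureReal_mono fun x hx => h.trans hx

/-- Continuity from below along `{f ≥ 1/(k+1)}`, which exhaust the full-mass set `{f > 0}`. It keeps
the generalized inverse positive and its defining set bounded below. -/
theorem exists_lt_law_level (hf : IsProbDensity f) {α : ℝ} (hα : α < 1) :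
    ∃ t > 0, α < (law f).real {x | t ≤ f x} := by
  have := isProbabilityMeasure_law hf
  have hpos : (law f).real {x | 0 < f x} = 1 := by
    have h2 : {x | 0 < f x} = {x | f x ≤ 0}ᶜ := by
      ext x
      simp
    rw [h2, probReal_compl_eq_one_sub (measurableSet_le hf.measurable measurable_const),
      measureReal_def, law_nonpos_eq_zero hf]
    simp
  have hU : {x | 0 < f x} = ⋃ k : ℕ, {x | 1 / ((k : ℝ) + 1) ≤ f x} := by
    ext x
    simp only [Set.mem_ofPred_eq, Set.mem_iUnion]
    refine ⟨fun h => ?_, fun ⟨k, hk⟩ => lt_of_lt_of_le (by positivity) hk⟩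
    obtain ⟨k, hk⟩ := exists_nat_one_div_lt h
    exact ⟨k, hk.le⟩
  have hmono : Monotone fun k : ℕ => {x | 1 / ((k : ℝ) + 1) ≤ f x} := by
    intro a b hab x (hx : 1 / ((a : ℝ) + 1) ≤ f x)
    refine le_trans ?_ hx
    have : (a : ℝ) ≤ b := by exact_mod_cast hab
    gcongr
  have hlim := tendsto_measure_iUnion_atTop (μ := law f) hmono
  rw [← hU] at hlim
  have hlim' := (ENNReal.tendsto_toReal (measure_ne_top _ _)).comp hlim
  have hev := hlim'.eventually (lt_mem_nhds (show α < ((law f) {x | 0 < f x}).toReal by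
    rw [← measureReal_def, hpos]; exact hα))
  obtain ⟨k, hk⟩ := hev.exists
  exact ⟨1 / ((k : ℝ) + 1), by positivity, hk⟩

theorem bddBelow_massInv (hf : IsProbDensity f) {α : ℝ} (hα : α < 1) :
    BddBelow {t : ℝ | (law f).real {x | t ≤ f x} ≤ α} := by
  obtain ⟨t, -, h⟩ := exists_lt_law_level hf hα
  refine ⟨t, fun s hs => ?_⟩
  by_contra! hst
  exact absurd (h.trans_le (law_level_anti hf hst.le)) (not_lt.2 hs)

theorem massInv_set_nonempty (hb : BoundedDensity f) {α : ℝ} (hα : 0 ≤ α) :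
    {t : ℝ | (law f).real {x | t ≤ f x} ≤ α}.Nonempty := by
  obtain ⟨M, hM⟩ := hb
  refine ⟨M + 1, ?_⟩
  have : {x | M + 1 ≤ f x} = ∅ := by
    ext x
    simp only [Set.mem_ofPred_eq, Set.mem_empty_iff_false, iff_false, not_le]
    linarith [hM x]
  simp only [Set.mem_ofPred_eq, this]
  simpa using hα

theorem massInv_pos (hf : IsProbDensity f) (hb : BoundedDensity f) {α : ℝ}
    (hα : α ∈ Set.Ico (0 : ℝ) 1) : 0 < massInv (law f) f α := by
  obtain ⟨t, ht, h⟩ := exists_lt_law_level hf hα.2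
  refine ht.trans_le (le_csInf (massInv_set_nonempty hb hα.1) fun s hs => ?_)
  by_contra! hst
  exact absurd (h.trans_le (law_level_anti hf hst.le)) (not_lt.2 hs)

theorem massInv_anti (hf : IsProbDensity f) (hb : BoundedDensity f) {α β : ℝ} (hα : 0 ≤ α)
    (h : α ≤ β) (hβ : β < 1) : massInv (law f) f β ≤ massInv (law f) f α :=
  csInf_le_csInf (bddBelow_massInv hf hβ) (massInv_set_nonempty hb hα) fun _ ht => le_trans ht h

/-- The level set at the generalized inverse has exactly the prescribed mass. -/
theorem law_level_massInv (hf : IsProbDensity f) (hb : BoundedDensity f) (hflat : NoFlatParts f)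
    {α : ℝ} (hα : α ∈ Set.Ico (0 : ℝ) 1) :
    (law f).real {x | massInv (law f) f α ≤ f x} = α := by
  have := isProbabilityMeasure_law hf
  set q := massInv (law f) f α with hq
  refine le_antisymm ?_ ?_
  · rw [law_level_le_iff hf hflat]
    -- Levels just above the infimum belong to the defining set; continuity from above passes to the
    -- limit.
    have hanti : Antitone fun k : ℕ => {x | f x ≤ q + 1 / ((k : ℝ) + 1)} := by
      intro a b hab x (hx : f x ≤ q + 1 / ((b : ℝ) + 1))
      have : (a : ℝ) ≤ b := by exact_mod_cast hab
      refine le_trans hx ?_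
      gcongr
    have hI : {x | f x ≤ q} = ⋂ k : ℕ, {x | f x ≤ q + 1 / ((k : ℝ) + 1)} := by
      ext x
      simp only [Set.mem_ofPred_eq, Set.mem_iInter]
      refine ⟨fun h k => h.trans (le_add_of_nonneg_right (by positivity)), fun h => ?_⟩
      refine le_of_forall_pos_le_add fun r hr => ?_
      obtain ⟨k, hk⟩ := exists_nat_one_div_lt hr
      linarith [h k]
    have hlim := tendsto_measure_iInter_atTop (μ := law f)
      (fun k => (measurableSet_le hf.measurable measurable_const).nullMeasurableSet) hanti
      ⟨0, measure_ne_top _ _⟩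
    rw [← hI] at hlim
    refine ge_of_tendsto' ((ENNReal.tendsto_toReal (measure_ne_top _ _)).comp hlim) fun k => ?_
    refine (law_level_le_iff hf hflat _ _).1 ?_
    obtain ⟨s, hs, hsq⟩ := exists_lt_of_csInf_lt (massInv_set_nonempty hb hα.1)
      (show q < q + 1 / ((k : ℝ) + 1) from lt_add_of_pos_right _ (by positivity))
    exact (law_level_anti hf hsq.le).trans hs
  -- Levels strictly below the infimum have mass above `α`, and so does the limit in the weak sense.
  · have hanti : Antitone fun k : ℕ => {x | q - 1 / ((k : ℝ) + 1) ≤ f x} := by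
      intro a b hab x (hx : q - 1 / ((b : ℝ) + 1) ≤ f x)
      have : (a : ℝ) ≤ b := by exact_mod_cast hab
      refine le_trans ?_ hx
      gcongr
    have hI : {x | q ≤ f x} = ⋂ k : ℕ, {x | q - 1 / ((k : ℝ) + 1) ≤ f x} := by
      ext x
      simp only [Set.mem_ofPred_eq, Set.mem_iInter]
      refine ⟨fun h k => (sub_le_self _ (by positivity)).trans h, fun h => ?_⟩
      refine le_of_forall_pos_le_add fun r hr => ?_
      obtain ⟨k, hk⟩ := exists_nat_one_div_lt hr
      linarith [h k]
    have hlim := tendsto_measure_iInter_atTop (μ := law f)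
      (fun k : ℕ => (measurableSet_level hf (q - 1 / ((k : ℝ) + 1))).nullMeasurableSet) hanti
      ⟨0, measure_ne_top _ _⟩
    rw [← hI] at hlim
    refine ge_of_tendsto' ((ENNReal.tendsto_toReal (measure_ne_top _ _)).comp hlim) fun k => ?_
    by_contra! hlt
    have : q ≤ q - 1 / ((k : ℝ) + 1) := csInf_le (bddBelow_massInv hf hα.2) hlt.le
    have : (0 : ℝ) < 1 / ((k : ℝ) + 1) := by positivity
    linarith

/-- Level sets of the density have the least volume among the sets of at least the same mass. -/
theorem volume_level_le (hf : IsProbDensity f) {t : ℝ} (ht : 0 < t) {B : Set (Space d)}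
    (hB : MeasurableSet B) (h : (law f).real {x | t ≤ f x} ≤ (law f).real B) :
    volume {x | t ≤ f x} ≤ volume B := by
  have := isProbabilityMeasure_law hf
  set L := {x | t ≤ f x} with hL
  have hLm : MeasurableSet L := measurableSet_level hf t
  have h' : law f L ≤ law f B :=
    (ENNReal.toReal_le_toReal (measure_ne_top _ _) (measure_ne_top _ _)).1 h
  have h1 : law f (L \ B) ≤ law f (B \ L) := by
    rw [← measure_inter_add_sdiff L hB, ← measure_inter_add_sdiff B hLm, Set.inter_comm B L] at h'
    exact (ENNReal.add_le_add_iff_left (measure_ne_top _ _)).1 h'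
  -- After the common part is cancelled, the density is at least `t` on `L \ B` and below `t` on `B
  -- \ L`.
  have h2 : ENNReal.ofReal t * volume (L \ B) ≤ ENNReal.ofReal t * volume (B \ L) :=
    (ofReal_mul_volume_le_law hf (hLm.diff hB) fun x hx => hx.1).trans (h1.trans
      (law_le_ofReal_mul_volume (hB.diff hLm) fun x hx => (not_le.1 hx.2).le))
  have h3 : volume (L \ B) ≤ volume (B \ L) :=
    (ENNReal.mul_le_mul_iff_right (by simpa using ht) ENNReal.ofReal_ne_top).1 h2
  rw [← measure_inter_add_sdiff L hB, ← measure_inter_add_sdiff B hLm, Set.inter_comm B L]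
  gcongr

theorem ofReal_mvStar (hf : IsProbDensity f) (hb : BoundedDensity f) {α : ℝ}
    (hα : α ∈ Set.Ico (0 : ℝ) 1) :
    ENNReal.ofReal (mvStar f α) = volume {x | massInv (law f) f α ≤ f x} := by
  rw [mvStar, mvCurve, measureReal_def,
    ENNReal.ofReal_toReal (volume_level_lt_top hf (massInv_pos hf hb hα)).ne]

theorem mvStar_le_volume (hf : IsProbDensity f) (hb : BoundedDensity f) (hflat : NoFlatParts f)
    {α : ℝ} (hα : α ∈ Set.Ico (0 : ℝ) 1) {B : Set (Space d)} (hB : MeasurableSet B)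
    (hB' : volume B < ⊤) (h : α ≤ (law f).real B) : mvStar f α ≤ volume.real B := by
  refine ENNReal.toReal_mono hB'.ne (volume_level_le hf (massInv_pos hf hb hα) hB ?_)
  rwa [law_level_massInv hf hb hflat hα]

theorem volume_le_mvStar (hf : IsProbDensity f) (hb : BoundedDensity f) (hflat : NoFlatParts f)
    {α : ℝ} (hα : α ∈ Set.Ico (0 : ℝ) 1) {A : Set (Space d)} (hA : IsMinVolSet (law f) α A) :
    volume A ≤ ENNReal.ofReal (mvStar f α) := by
  rw [ofReal_mvStar hf hb hα]
  exact hA.2.2 _ (measurableSet_level hf _) (law_level_massInv hf hb hflat hα).ge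

theorem mvStar_nonneg (f : Space d → ℝ) (α : ℝ) : 0 ≤ mvStar f α := measureReal_nonneg

theorem mvStar_mono (hf : IsProbDensity f) (hb : BoundedDensity f) {α β : ℝ} (hα : 0 ≤ α)
    (h : α ≤ β) (hβ : β < 1) : mvStar f α ≤ mvStar f β :=
  measureReal_mono (fun _ hx => (massInv_anti hf hb hα h hβ).trans hx)
    (volume_level_lt_top hf (massInv_pos hf hb ⟨hα.trans h, hβ⟩)).ne

theorem mvStar_zero (hf : IsProbDensity f) (hb : BoundedDensity f) (hflat : NoFlatParts f) :
    mvStar f 0 = 0 := by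
  have := isProbabilityMeasure_law hf
  have h0 : (0 : ℝ) ∈ Set.Ico (0 : ℝ) 1 := by simp
  have h1 : (law f).real {x | massInv (law f) f 0 ≤ f x} ≤ (law f).real ∅ := by
    rw [law_level_massInv hf hb hflat h0]
    simp
  have h := volume_level_le hf (massInv_pos hf hb h0) MeasurableSet.empty h1
  rw [measure_empty, nonpos_iff_eq_zero] at h
  rw [mvStar, mvCurve, measureReal_def, h, ENNReal.toReal_zero]

theorem quantileStar_pos (hf : IsProbDensity f) (hb : BoundedDensity f) (hflat : NoFlatParts f)
    {α : ℝ} (hα : α ∈ Set.Ico (0 : ℝ) 1) : 0 < quantileStar f α := by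
  rw [quantileStar_eq_massInv hf hflat]
  exact massInv_pos hf hb hα

theorem quantileStar_anti (hf : IsProbDensity f) (hb : BoundedDensity f) (hflat : NoFlatParts f)
    {α β : ℝ} (hα : 0 ≤ α) (h : α ≤ β) (hβ : β < 1) : quantileStar f β ≤ quantileStar f α := by
  rw [quantileStar_eq_massInv hf hflat, quantileStar_eq_massInv hf hflat]
  exact massInv_anti hf hb hα h hβ

theorem deriv_mvStar (hd : MVDerivLLogL f) {α : ℝ} (hα : α ∈ Set.Ioo (0 : ℝ) 1) :
    deriv (mvStar f) α = 1 / quantileStar f α :=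
  ((hd.1 α ⟨hα.1.le, hα.2⟩).hasDerivAt (Ico_mem_nhds hα.1 hα.2)).deriv

theorem deriv_mvStar_nonneg (hf : IsProbDensity f) (hb : BoundedDensity f) (hflat : NoFlatParts f)
    (hd : MVDerivLLogL f) {α : ℝ} (hα : α ∈ Set.Ioo (0 : ℝ) 1) : 0 ≤ deriv (mvStar f) α := by
  rw [deriv_mvStar hd hα]
  exact (one_div_pos.2 (quantileStar_pos hf hb hflat ⟨hα.1.le, hα.2⟩)).le

theorem le_lLogLFun (y : ℝ) : |y| ≤ lLogLFun y := by
  rw [lLogLFun]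
  nlinarith [abs_nonneg y, Real.posLog_nonneg (x := |y|)]

theorem integrableOn_deriv_mvStar (hd : MVDerivLLogL f) :
    IntegrableOn (deriv (mvStar f)) (Set.Ioo 0 1) := by
  refine Integrable.mono' hd.2 (measurable_deriv _).aestronglyMeasurable (ae_of_all _ fun x => ?_)
  exact le_lLogLFun _

theorem intervalIntegrable_of_Ioo {g : ℝ → ℝ} (hg : IntegrableOn g (Set.Ioo 0 1)) {a b : ℝ}
    (ha : 0 ≤ a) (hab : a ≤ b) (hb : b ≤ 1) : IntervalIntegrable g volume a b := by
  rw [intervalIntegrable_iff_integrableOn_Ioo_of_le hab]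
  exact hg.mono_set (Set.Ioo_subset_Ioo ha hb)

/-- The fundamental theorem of calculus needs only continuity at the endpoints, so one-sided
differentiability at `0` suffices; `L log L` supplies integrability. -/
theorem integral_deriv_mvStar (hd : MVDerivLLogL f) {a b : ℝ} (ha : 0 ≤ a) (hab : a ≤ b)
    (hb1 : b < 1) : ∫ x in a..b, deriv (mvStar f) x = mvStar f b - mvStar f a := by
  refine intervalIntegral.integral_eq_sub_of_hasDerivAt_of_le hab ?_ ?_
    (intervalIntegrable_of_Ioo (integrableOn_deriv_mvStar hd) ha hab hb1.le)
  · intro x hx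
    exact (hd.1 x ⟨ha.trans hx.1, hx.2.trans_lt hb1⟩).continuousWithinAt.mono
      fun y hy => ⟨ha.trans hy.1, hy.2.trans_lt hb1⟩
  · intro x hx
    have hx' : x ∈ Set.Ioo (0 : ℝ) 1 := ⟨ha.trans_lt hx.1, hx.2.trans hb1⟩
    rw [deriv_mvStar hd hx']
    exact (hd.1 x ⟨hx'.1.le, hx'.2⟩).hasDerivAt (Ico_mem_nhds hx'.1 hx'.2)

/-- The slope `1 / Q*` is nondecreasing, hence at most its value at `β`. -/
theorem mvStar_sub_le (hf : IsProbDensity f) (hb : BoundedDensity f) (hflat : NoFlatParts f)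
    (hd : MVDerivLLogL f) {a b β : ℝ} (ha : 0 ≤ a) (hab : a ≤ b) (hbβ : b ≤ β) (hβ : β < 1) :
    mvStar f b - mvStar f a ≤ (b - a) / quantileStar f β := by
  rw [← integral_deriv_mvStar hd ha hab (hbβ.trans_lt hβ)]
  have hc : ∫ _x in a..b, 1 / quantileStar f β = (b - a) / quantileStar f β := by
    rw [intervalIntegral.integral_const, smul_eq_mul, mul_one_div]
  rw [← hc]
  refine intervalIntegral.integral_mono_on_of_le_Ioo hab
    (intervalIntegrable_of_Ioo (integrableOn_deriv_mvStar hd) ha hab (hbβ.trans hβ.le))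
    intervalIntegrable_const fun x hx => ?_
  have hx0 : 0 < x := ha.trans_lt hx.1
  have hxβ : x ≤ β := hx.2.le.trans hbβ
  rw [deriv_mvStar hd ⟨hx0, hxβ.trans_lt hβ⟩]
  exact one_div_le_one_div_of_le (quantileStar_pos hf hb hflat ⟨hx0.le.trans hxβ, hβ⟩)
    (quantileStar_anti hf hb hflat hx0.le hxβ hβ)

theorem setIntegral_deriv_mvStar_le (hd : MVDerivLLogL f) :
    ∫ x in Set.Ioo (0 : ℝ) 1, deriv (mvStar f) x ≤ lLogLNorm (deriv (mvStar f)) :=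
  integral_mono (integrableOn_deriv_mvStar hd) hd.2 fun _ => (le_abs_self _).trans (le_lLogLFun _)

/-- On `(1-ε, 1)` the slope is at least `1 / Q*(1-ε)`, so its integral there is at least `ε /
Q*(1-ε)`. -/
theorem le_quantileStar_mul_lLogLNorm (hf : IsProbDensity f) (hb : BoundedDensity f)
    (hflat : NoFlatParts f) (hd : MVDerivLLogL f) {ε : ℝ} (hε : ε ∈ Set.Ioo (0 : ℝ) 1) :
    ε ≤ quantileStar f (1 - ε) * lLogLNorm (deriv (mvStar f)) := by
  have hq := quantileStar_pos hf hb hflat (α := 1 - ε) ⟨by linarith [hε.2], by linarith [hε.1]⟩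
  have hsub : Set.Ioo (1 - ε) 1 ⊆ Set.Ioo (0 : ℝ) 1 :=
    Set.Ioo_subset_Ioo_left (by linarith [hε.2])
  have h1 : ε * (1 / quantileStar f (1 - ε)) ≤
      ∫ x in Set.Ioo (1 - ε) 1, deriv (mvStar f) x := by
    have hc : ∫ _x in Set.Ioo (1 - ε) 1, 1 / quantileStar f (1 - ε) =
        ε * (1 / quantileStar f (1 - ε)) := by
      rw [setIntegral_const, smul_eq_mul, Real.volume_real_Ioo_of_le (by linarith [hε.1])]
      ring
    rw [← hc]
    refine setIntegral_mono_on (by simp) ((integrableOn_deriv_mvStar hd).mono_set hsub)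
      measurableSet_Ioo fun x hx => ?_
    rw [deriv_mvStar hd (hsub hx)]
    exact one_div_le_one_div_of_le (quantileStar_pos hf hb hflat ⟨(hsub hx).1.le, hx.2⟩)
      (quantileStar_anti hf hb hflat (by linarith [hε.2]) hx.1.le hx.2)
  have h2 : ∫ x in Set.Ioo (1 - ε) 1, deriv (mvStar f) x ≤
      ∫ x in Set.Ioo (0 : ℝ) 1, deriv (mvStar f) x := by
    refine setIntegral_mono_set (integrableOn_deriv_mvStar hd) ?_ hsub.eventuallyLE
    filter_upwards [ae_restrict_mem measurableSet_Ioo] with x hx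
    exact deriv_mvStar_nonneg hf hb hflat hd hx
  have h3 := (h1.trans h2).trans (setIntegral_deriv_mvStar_le hd)
  rw [mul_one_div, div_le_iff₀ hq] at h3
  linarith

/-- The volume of the support is at most the integral of the derivative of the optimal curve. -/
theorem volume_support_le (hf : IsProbDensity f) (hb : BoundedDensity f) (hflat : NoFlatParts f)
    (hd : MVDerivLLogL f) :
    volume {x | 0 < f x} ≤ ENNReal.ofReal (∫ x in Set.Ioo (0 : ℝ) 1, deriv (mvStar f) x) := by
  have := isProbabilityMeasure_law hf
  set b : ℕ → ℝ := fun k => 1 - 1 / ((k : ℝ) + 1) with hbdef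
  have hbI : ∀ k, b k ∈ Set.Ico (0 : ℝ) 1 := fun k => by
    have h1 : (0 : ℝ) < 1 / ((k : ℝ) + 1) := by positivity
    have h2 : 1 / ((k : ℝ) + 1) ≤ 1 := by
      rw [div_le_one (by positivity)]
      linarith [(Nat.cast_nonneg k : (0 : ℝ) ≤ k)]
    exact ⟨by simp only [hbdef]; linarith, by simp only [hbdef]; linarith⟩
  have hbm : Monotone b := by
    intro i j hij
    have : (i : ℝ) ≤ j := by exact_mod_cast hij
    simp only [hbdef]
    gcongr
  set L : ℕ → Set (Space d) := fun k => {x | massInv (law f) f (b k) ≤ f x} with hL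
  have hLm : Monotone L := fun i j hij x hx =>
    (massInv_anti hf hb (hbI i).1 (hbm hij) (hbI j).2).trans hx
  have hU : MeasurableSet (⋃ k, L k) := MeasurableSet.iUnion fun k => measurableSet_level hf _
  have hlaw : (law f).real (⋃ k, L k) = 1 := by
    refine le_antisymm measureReal_le_one ?_
    have hlim : Filter.Tendsto b Filter.atTop (nhds 1) := by
      simpa [hbdef] using tendsto_one_div_add_atTop_nhds_zero_nat.const_sub (1 : ℝ)
    refine le_of_tendsto' hlim fun k => ?_
    rw [← law_level_massInv hf hb hflat (hbI k)]
    exact measureReal_mono (Set.subset_iUnion L k)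
  have hnull : law f (⋃ k, L k)ᶜ = 0 := by
    have h := probReal_compl_eq_one_sub (μ := law f) hU
    rw [hlaw, sub_self, measureReal_eq_zero_iff] at h
    exact h
  -- A set null for the law is Lebesgue null where the density is positive.
  have hnull' : volume ({x | 0 < f x} \ ⋃ k, L k) = 0 := by
    rw [law, withDensity_apply_eq_zero hf.measurable.ennreal_ofReal] at hnull
    refine measure_mono_null (fun x hx => ?_) hnull
    refine ⟨?_, hx.2⟩
    have : 0 < f x := hx.1
    simpa using this
  calc volume {x | 0 < f x} ≤ volume (⋃ k, L k) :=
        measure_mono_ae (by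
          have h : ∀ᵐ x, x ∉ {x | 0 < f x} \ ⋃ k, L k := measure_eq_zero_iff_ae_notMem.1 hnull'
          filter_upwards [h] with x hx hx0
          by_contra hxU
          exact hx ⟨hx0, hxU⟩)
    _ = ⨆ k, volume (L k) := hLm.measure_iUnion
    _ ≤ _ := iSup_le fun k => by
        rw [← ofReal_mvStar hf hb (hbI k)]
        refine ENNReal.ofReal_le_ofReal ?_
        have h := integral_deriv_mvStar hd le_rfl (hbI k).1 (hbI k).2
        rw [mvStar_zero hf hb hflat, sub_zero] at h
        rw [← h, intervalIntegral.integral_of_le (hbI k).1, integral_Ioc_eq_integral_Ioo]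
        refine setIntegral_mono_set (integrableOn_deriv_mvStar hd) ?_
          (Set.Ioo_subset_Ioo_right (hbI k).2.le).eventuallyLE
        filter_upwards [ae_restrict_mem measurableSet_Ioo] with x hx
        exact deriv_mvStar_nonneg hf hb hflat hd hx


/-! ### Counting large increments through `L log L` -/

theorem splitCount_le_card (vol : ℝ → ℝ) (ε τ : ℝ) (j N : ℕ) : splitCount vol ε τ j 0 N ≤ N := by
  simpa [splitCount] using Finset.card_filter_le (Finset.Ico 0 N) fun l =>
    τ < vol (dyadicLevel ε j (l + 1)) - vol (dyadicLevel ε j l)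

theorem sum_two_pow_filter_le (J : ℕ) {B : ℝ} (hB : 0 ≤ B) :
    ∑ j ∈ (Finset.range J).filter (fun j : ℕ => (2 : ℝ) ^ j ≤ B), (2 : ℝ) ^ j ≤ 2 * B := by
  induction J with
  | zero => simpa using hB
  | succ J ih =>
    by_cases h : (2 : ℝ) ^ J ≤ B
    · calc ∑ j ∈ (Finset.range (J + 1)).filter (fun j : ℕ => (2 : ℝ) ^ j ≤ B), (2 : ℝ) ^ j
          ≤ ∑ j ∈ Finset.range (J + 1), (2 : ℝ) ^ j :=
            Finset.sum_le_sum_of_subset_of_nonneg (Finset.filter_subset _ _)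
              fun _ _ _ => by positivity
        _ = 2 ^ (J + 1) - 1 := by
            rw [geom_sum_eq (by norm_num)]
            norm_num
        _ ≤ 2 * B := by
            rw [pow_succ]
            linarith
    · rwa [Finset.range_add_one, Finset.filter_insert, if_neg h]

/-- The number of dyadic scales between `v` and `2 y` is logarithmic in `y / v`. -/
theorem card_dyadic_scales_le (J : ℕ) {v η y : ℝ} (hv : 0 < v) :
    (((Finset.range J).filter fun j : ℕ => v < 2 ^ j * η ∧ 2 ^ j * η ≤ 2 * y).card : ℝ) ≤
      (2 + 2 * Real.posLog v⁻¹) * (1 + Real.posLog |y|) := by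
  set T := (Finset.range J).filter fun j : ℕ => v < 2 ^ j * η ∧ 2 ^ j * η ≤ 2 * y with hT
  have hv' := Real.posLog_nonneg (x := v⁻¹)
  have hy' := Real.posLog_nonneg (x := |y|)
  rcases T.eq_empty_or_nonempty with h | h
  · rw [h]
    simp only [Finset.card_empty, Nat.cast_zero]
    positivity
  · have hmin := (Finset.mem_filter.1 (T.min'_mem h)).2
    have hmax := (Finset.mem_filter.1 (T.max'_mem h)).2
    set a := T.min' h
    set b := T.max' h
    have hab : a ≤ b := T.min'_le_max' h
    have hcard : T.card ≤ b - a + 1 := by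
      have : T ⊆ Finset.Icc a b := fun j hj =>
        Finset.mem_Icc.2 ⟨T.min'_le j hj, T.le_max' j hj⟩
      have := Finset.card_le_card this
      rw [Nat.card_Icc] at this
      omega
    have hcard' : (T.card : ℝ) ≤ ((b - a : ℕ) : ℝ) + 1 := by exact_mod_cast hcard
    -- Comparing the smallest and the largest admissible scale bounds the number of doublings
    -- between them.
    have hpow : (2 : ℝ) ^ (b - a) * v ≤ 2 * y := by
      calc (2 : ℝ) ^ (b - a) * v ≤ 2 ^ (b - a) * (2 ^ a * η) := by gcongr; exact hmin.1.le
        _ = 2 ^ b * η := by rw [← mul_assoc, ← pow_add, Nat.sub_add_cancel hab]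
        _ ≤ 2 * y := hmax.2
    have hy0 : 0 < y := by
      have : 0 < (2 : ℝ) ^ (b - a) * v := by positivity
      linarith
    have hlog : ((b - a : ℕ) : ℝ) * Real.log 2 ≤ Real.log 2 + Real.log (y * v⁻¹) := by
      rw [← Real.log_pow, ← Real.log_mul (by norm_num) (by positivity)]
      refine Real.log_le_log (by positivity) ?_
      rw [← mul_assoc, ← div_eq_mul_inv, le_div_iff₀ hv]
      exact hpow
    have hlog' : Real.log (y * v⁻¹) ≤ Real.posLog |y| + Real.posLog v⁻¹ := by
      rw [abs_of_pos hy0]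
      exact (le_max_right _ _).trans Real.posLog_mul
    have hl2 := Real.log_two_gt_d9
    -- The factor `2` comes from `log 2 > 1/2`.
    have hD : ((b - a : ℕ) : ℝ) ≤ 1 + 2 * (Real.posLog |y| + Real.posLog v⁻¹) := by
      by_contra! hlt
      nlinarith
    nlinarith [mul_nonneg hv' hy']

/-- The part of a function above the scale `2 ^ j η / 2`. -/
noncomputable def aboveScale (g : ℝ → ℝ) (η : ℝ) (j : ℕ) : ℝ → ℝ :=
  {x | 2 ^ j * η ≤ 2 * g x}.indicator g

theorem integrableOn_aboveScale {g : ℝ → ℝ} (hgm : Measurable g)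
    (hg : IntegrableOn g (Set.Ioo 0 1)) (η : ℝ) (j : ℕ) :
    IntegrableOn (aboveScale g η j) (Set.Ioo 0 1) :=
  hg.indicator (measurableSet_le measurable_const (hgm.const_mul 2))

theorem aboveScale_nonneg {g : ℝ → ℝ} {x : ℝ} (hx : 0 ≤ g x) (η : ℝ) (j : ℕ) :
    0 ≤ aboveScale g η j x := by
  by_cases h : x ∈ {x | 2 ^ j * η ≤ 2 * g x}
  · rwa [aboveScale, Set.indicator_of_mem h]
  · rw [aboveScale, Set.indicator_of_notMem h]

/-- At each depth, the splitting nodes are paid for by the part of the derivative above the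
scale of that depth. -/
theorem splitCount_mul_le {V g : ℝ → ℝ} (hgm : Measurable g) (hg : IntegrableOn g (Set.Ioo 0 1))
    (hg0 : ∀ x ∈ Set.Ioo (0 : ℝ) 1, 0 ≤ g x)
    (hV : ∀ a b, 0 ≤ a → a ≤ b → b < 1 → ∫ x in a..b, g x = V b - V a)
    {ε η : ℝ} (hε : ε ∈ Set.Ioo (0 : ℝ) 1) (hη : 0 < η) (j : ℕ) :
    (splitCount V ε η j 0 (2 ^ j) : ℝ) * (η / 2) ≤
      ∫ x in Set.Ioo (0 : ℝ) 1, aboveScale g η j x := by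
  have hε1 := hε.2
  have hh := integrableOn_aboveScale hgm hg η j
  have hlev : ∀ k, k ≤ 2 ^ j → dyadicLevel ε j k ≤ 1 := fun k hk =>
    (dyadicLevel_le hε1 hk).trans (by linarith [hε.1])
  have hhi : ∀ k, k < 2 ^ j → IntervalIntegrable (aboveScale g η j) volume (dyadicLevel ε j k)
      (dyadicLevel ε j (k + 1)) := fun k hk =>
    intervalIntegrable_of_Ioo hh (dyadicLevel_nonneg hε1 _ _) (dyadicLevel_lt_succ hε1 _ _).le
      (hlev _ hk)
  have hnn : ∀ k ∈ Finset.Ico 0 (2 ^ j),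
      0 ≤ ∫ x in dyadicLevel ε j k..dyadicLevel ε j (k + 1), aboveScale g η j x := by
    intro k hk
    rw [intervalIntegral.integral_of_le (dyadicLevel_lt_succ hε1 _ _).le,
      integral_Ioc_eq_integral_Ioo]
    refine setIntegral_nonneg measurableSet_Ioo fun x hx => ?_
    exact aboveScale_nonneg (hg0 x ⟨(dyadicLevel_nonneg hε1 _ _).trans_lt hx.1,
      hx.2.trans_le (hlev _ (Finset.mem_Ico.1 hk).2)⟩) η j
  have hnode : ∀ k ∈ (Finset.Ico 0 (2 ^ j)).filter (fun l =>
      η < V (dyadicLevel ε j (l + 1)) - V (dyadicLevel ε j l)),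
      η / 2 ≤ ∫ x in dyadicLevel ε j k..dyadicLevel ε j (k + 1), aboveScale g η j x := by
    intro k hk
    obtain ⟨hk, hsplit⟩ := Finset.mem_filter.1 hk
    have hk' := (Finset.mem_Ico.1 hk).2
    have hlt : dyadicLevel ε j (k + 1) < 1 :=
      (dyadicLevel_le hε1 hk').trans_lt (by linarith [hε.1])
    rw [← hV _ _ (dyadicLevel_nonneg hε1 _ _) (dyadicLevel_lt_succ hε1 _ _).le hlt] at hsplit
    -- Values below `2 ^ j η / 2` contribute at most `(1-ε) η / 2` on an interval of length `(1-ε) /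
    -- 2 ^ j`; over half of the increment must come from above.
    have hle : ∫ x in dyadicLevel ε j k..dyadicLevel ε j (k + 1), g x ≤
        ∫ x in dyadicLevel ε j k..dyadicLevel ε j (k + 1),
          (aboveScale g η j x + 2 ^ j * η / 2) := by
      refine intervalIntegral.integral_mono_on_of_le_Ioo (dyadicLevel_lt_succ hε1 _ _).le
        (intervalIntegrable_of_Ioo hg (dyadicLevel_nonneg hε1 _ _) (dyadicLevel_lt_succ hε1 _ _).le
          hlt.le) ((hhi k hk').add intervalIntegrable_const) fun x _ => ?_
      by_cases h : x ∈ {x | 2 ^ j * η ≤ 2 * g x}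
      · rw [aboveScale, Set.indicator_of_mem h]
        linarith [(by positivity : 0 ≤ 2 ^ j * η / 2)]
      · rw [aboveScale, Set.indicator_of_notMem h]
        have : 2 * g x < 2 ^ j * η := not_le.1 h
        linarith
    rw [intervalIntegral.integral_add (hhi k hk') intervalIntegrable_const,
      intervalIntegral.integral_const, dyadicLevel_succ_sub, smul_eq_mul] at hle
    have hlen : (1 - ε) / 2 ^ j * (2 ^ j * η / 2) = (1 - ε) * (η / 2) := by
      field_simp
    rw [hlen] at hle
    nlinarith [hε.1]
  calc (splitCount V ε η j 0 (2 ^ j) : ℝ) * (η / 2)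
      ≤ ∑ k ∈ (Finset.Ico 0 (2 ^ j)).filter (fun l =>
          η < V (dyadicLevel ε j (l + 1)) - V (dyadicLevel ε j l)),
          ∫ x in dyadicLevel ε j k..dyadicLevel ε j (k + 1), aboveScale g η j x := by
        rw [splitCount, ← nsmul_eq_mul]
        exact Finset.card_nsmul_le_sum _ _ _ hnode
    _ ≤ ∑ k ∈ Finset.Ico 0 (2 ^ j),
          ∫ x in dyadicLevel ε j k..dyadicLevel ε j (k + 1), aboveScale g η j x :=
        Finset.sum_le_sum_of_subset_of_nonneg (Finset.filter_subset _ _) fun k hk _ => hnn k hk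
    _ = ∫ x in dyadicLevel ε j 0..dyadicLevel ε j (2 ^ j), aboveScale g η j x := by
        rw [← Finset.range_eq_Ico]
        exact intervalIntegral.sum_integral_adjacent_intervals fun k hk => hhi k hk
    _ ≤ _ := by
        have h0 : 0 ≤ dyadicLevel ε j 0 := dyadicLevel_nonneg hε1 _ _
        have h01 : dyadicLevel ε j 0 ≤ dyadicLevel ε j (2 ^ j) := by
          have : dyadicLevel ε j 0 = 0 := by simp [dyadicLevel]
          rw [this]
          exact dyadicLevel_nonneg hε1 _ _
        rw [intervalIntegral.integral_of_le h01, integral_Ioc_eq_integral_Ioo]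
        refine setIntegral_mono_set hh ?_ (Set.Ioo_subset_Ioo h0 (hlev _ le_rfl)).eventuallyLE
        filter_upwards [ae_restrict_mem measurableSet_Ioo] with x hx
        exact aboveScale_nonneg (hg0 x hx) η j

/-- The total number of splitting nodes is controlled by the `L log L` functional. -/
theorem sum_splitCount_le {V g : ℝ → ℝ} (hgm : Measurable g) (hg : IntegrableOn g (Set.Ioo 0 1))
    (hg0 : ∀ x ∈ Set.Ioo (0 : ℝ) 1, 0 ≤ g x) (hL : MemLLogL g)
    (hV : ∀ a b, 0 ≤ a → a ≤ b → b < 1 → ∫ x in a..b, g x = V b - V a)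
    {ε η v : ℝ} (hε : ε ∈ Set.Ioo (0 : ℝ) 1) (hη : 0 < η) (hv : 0 < v) (hvL : v ≤ lLogLNorm g)
    (J : ℕ) :
    (∑ j ∈ Finset.range J, (splitCount V ε η j 0 (2 ^ j) : ℝ)) ≤
      (6 + 4 * Real.posLog v⁻¹) * (lLogLNorm g / η) := by
  -- Shallow depths, with `2 ^ j η ≤ v`, are bounded by all their nodes and sum to at most `2 v /
  -- η`. Deeper ones are paid for by `aboveScale`.
  rw [← Finset.sum_filter_add_sum_filter_not (Finset.range J) fun j : ℕ => (2 : ℝ) ^ j ≤ v / η]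
  have h1 : ∑ j ∈ (Finset.range J).filter (fun j : ℕ => (2 : ℝ) ^ j ≤ v / η),
      (splitCount V ε η j 0 (2 ^ j) : ℝ) ≤ 2 * (lLogLNorm g / η) := by
    calc _ ≤ ∑ j ∈ (Finset.range J).filter (fun j : ℕ => (2 : ℝ) ^ j ≤ v / η), (2 : ℝ) ^ j :=
          Finset.sum_le_sum fun j _ => by exact_mod_cast splitCount_le_card V ε η j (2 ^ j)
      _ ≤ 2 * (v / η) := sum_two_pow_filter_le J (by positivity)
      _ ≤ _ := by gcongr
  set T := (Finset.range J).filter (fun j : ℕ => ¬ (2 : ℝ) ^ j ≤ v / η) with hT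
  have hpoint : ∀ x ∈ Set.Ioo (0 : ℝ) 1, ∑ j ∈ T, aboveScale g η j x ≤
      (2 + 2 * Real.posLog v⁻¹) * lLogLFun (g x) := by
    intro x hx
    have hgx := hg0 x hx
    have hcard := card_dyadic_scales_le J (η := η) (y := g x) hv
    have hsum : ∑ j ∈ T, aboveScale g η j x =
        (((Finset.range J).filter fun j : ℕ =>
          v < 2 ^ j * η ∧ 2 ^ j * η ≤ 2 * g x).card : ℝ) * g x := by
      have hTT : ((Finset.range J).filter fun j : ℕ => v < 2 ^ j * η ∧ 2 ^ j * η ≤ 2 * g x) =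
          T.filter fun j : ℕ => 2 ^ j * η ≤ 2 * g x := by
        rw [hT, Finset.filter_filter]
        refine Finset.filter_congr fun j _ => ?_
        rw [not_le, div_lt_iff₀ hη]
      rw [hTT, ← nsmul_eq_mul, ← Finset.sum_const, Finset.sum_filter (s := T)]
      refine Finset.sum_congr rfl fun j _ => ?_
      simp only [aboveScale, Set.indicator_apply, Set.mem_ofPred_eq]
    rw [hsum, lLogLFun, abs_of_nonneg hgx, ← mul_assoc]
    rw [abs_of_nonneg hgx] at hcard
    gcongr
  have h2 : (∑ j ∈ T, (splitCount V ε η j 0 (2 ^ j) : ℝ)) * (η / 2) ≤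
      (2 + 2 * Real.posLog v⁻¹) * lLogLNorm g := by
    rw [Finset.sum_mul]
    calc _ ≤ ∑ j ∈ T, ∫ x in Set.Ioo (0 : ℝ) 1, aboveScale g η j x :=
          Finset.sum_le_sum fun j _ => splitCount_mul_le hgm hg hg0 hV hε hη j
      _ = ∫ x in Set.Ioo (0 : ℝ) 1, ∑ j ∈ T, aboveScale g η j x :=
          (integral_finsetSum _ fun j _ => integrableOn_aboveScale hgm hg η j).symm
      _ ≤ ∫ x in Set.Ioo (0 : ℝ) 1, (2 + 2 * Real.posLog v⁻¹) * lLogLFun (g x) :=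
          setIntegral_mono_on (integrable_finsetSum _ fun j _ => integrableOn_aboveScale hgm hg η j)
            (hL.const_mul _) measurableSet_Ioo hpoint
      _ = _ := integral_const_mul _ _
  have h3 : ∑ j ∈ T, (splitCount V ε η j 0 (2 ^ j) : ℝ) ≤
      (4 + 4 * Real.posLog v⁻¹) * (lLogLNorm g / η) := by
    rw [← mul_div_assoc, le_div_iff₀ hη]
    linarith
  linarith

end MassVolume

namespace MassVolume

/-! ### Empirical volumes, error bound and leaf bounds -/

variable {d n : ℕ} {f : Space d → ℝ} {𝒢 : Set (Set (Space d))} {ε δ : ℝ}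

theorem penalty_pos (F : Measure (Space d)) (𝒢 : Set (Set (Space d))) (hn : 1 ≤ n)
    (hδ : δ ∈ Set.Ioo (0 : ℝ) 1) : 0 < penalty F 𝒢 n δ := by
  have hn0 : (0 : ℝ) < n := by exact_mod_cast hn
  have hlog : 0 < Real.log (1 / δ) := Real.log_pos (by
    rw [lt_div_iff₀ hδ.1]; linarith [hδ.2])
  have h := rademacherAvg_nonneg F 𝒢 n
  have : 0 < Real.sqrt (Real.log (1 / δ) / (2 * n)) := Real.sqrt_pos.2 (by positivity)
  rw [penalty]
  linarith

/-- A bound free of `n` and of the class, needed to write a single leaf as at most a constant over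
the penalty. -/
theorem penalty_le (F : Measure (Space d)) [IsProbabilityMeasure F] (𝒢 : Set (Set (Space d)))
    (hn : 1 ≤ n) (hδ : δ ∈ Set.Ioo (0 : ℝ) 1) :
    penalty F 𝒢 n δ ≤ 2 + Real.sqrt (Real.log (1 / δ) / 2) := by
  have hn1 : (1 : ℝ) ≤ n := by exact_mod_cast hn
  have hlog : 0 ≤ Real.log (1 / δ) := Real.log_nonneg (by
    rw [le_div_iff₀ hδ.1]; linarith [hδ.2])
  have h := rademacherAvg_le_one F 𝒢 n
  have : Real.sqrt (Real.log (1 / δ) / (2 * n)) ≤ Real.sqrt (Real.log (1 / δ) / 2) := by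
    refine Real.sqrt_le_sqrt ?_
    gcongr
    linarith
  rw [penalty]
  linarith

/-- When the empirical masses are within `φ` of the masses, the empirical minimum volumes are within
`2 φ / Q*(1-ε)` of the optimal ones, from below. -/
theorem empVol_mem_Icc (hf : IsProbDensity f) (hb : BoundedDensity f) (hflat : NoFlatParts f)
    (hd : MVDerivLLogL f) (hε : ε ∈ Set.Ioo (0 : ℝ) 1) (h𝒢 : IsSetClass 𝒢)
    (hmin : ∀ α ∈ Set.Icc (0 : ℝ) (1 - ε), ∃ A ∈ 𝒢, IsMinVolSet (law f) α A) {φ : ℝ} (hφ : 0 ≤ φ)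
    {Ωhat : (Fin n → Space d) → ℝ → Set (Space d)} (hΩ : IsEmpMinVolEstimator 𝒢 φ ε n Ωhat)
    {x : Fin n → Space d} (hx : ∀ A ∈ 𝒢, |empMass x A - (law f).real A| ≤ φ) {α : ℝ}
    (hα : α ∈ Set.Icc (0 : ℝ) (1 - ε)) :
    empVol Ωhat x α ∈ Set.Icc (mvStar f α - 2 * φ / quantileStar f (1 - ε)) (mvStar f α) := by
  have := isProbabilityMeasure_law hf
  have hα1 : α ∈ Set.Ico (0 : ℝ) 1 := ⟨hα.1, by linarith [hα.2, hε.1]⟩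
  obtain ⟨A, hA, hAmin⟩ := hmin α hα
  have hAx : α - φ ≤ empMass x A := by
    have h1 := (abs_le.1 (hx A hA)).1
    have h2 := hAmin.2.1
    linarith
  obtain ⟨hB, hBx, hBmin⟩ := hΩ x α hα ⟨A, hA, hAx⟩
  constructor
  · have hF : α - 2 * φ ≤ (law f).real (Ωhat x α) := by
      have := (abs_le.1 (hx _ hB)).2
      linarith
    -- The level `α - 2 φ` may be negative, while the optimal curve is controlled on `[0, 1)` only.
    set β := max (α - 2 * φ) 0 with hβ
    have hβα : β ≤ α := max_le (by linarith) hα.1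
    have hβ0 : 0 ≤ β := le_max_right _ _
    have hV := mvStar_le_volume hf hb hflat ⟨hβ0, hβα.trans_lt hα1.2⟩
      (h𝒢.measurableSet _ hB) (h𝒢.volume_lt_top _ hB) (max_le hF measureReal_nonneg)
    have hsub := mvStar_sub_le hf hb hflat hd hβ0 hβα hα.2 (by linarith [hε.1])
    have hq := quantileStar_pos hf hb hflat (α := 1 - ε) ⟨by linarith [hε.2], by linarith [hε.1]⟩
    have hle : (α - β) / quantileStar f (1 - ε) ≤ 2 * φ / quantileStar f (1 - ε) := by
      gcongr
      linarith [le_max_left (α - 2 * φ) 0]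
    rw [empVol]
    linarith
  · rw [empVol, measureReal_def]
    refine ENNReal.toReal_le_of_le_ofReal (mvStar_nonneg f α) ?_
    exact (hBmin A hA hAx).trans (volume_le_mvStar hf hb hflat hα1 hAmin)

/-- At a leaf that fails the test, the right value exceeds the left one by at most `τ`, and the left
one is at most `MV*(α)` by monotonicity. At a leaf of maximal depth the slope bound acts over a
length of at most `1 / n`. Only the upper bound on `vol` enters. -/
theorem adaptiveMV_sub_le (hf : IsProbDensity f) (hb : BoundedDensity f) (hflat : NoFlatParts f)
    (hd : MVDerivLLogL f) (hε : ε ∈ Set.Ioo (0 : ℝ) 1) {vol : ℝ → ℝ}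
    (hvol : ∀ α ∈ Set.Icc (0 : ℝ) (1 - ε), vol α ≤ mvStar f α) {τ : ℝ} (hτ : 0 ≤ τ) (hn : 1 ≤ n)
    {α : ℝ} (hα : α ∈ Set.Icc (0 : ℝ) (1 - ε)) :
    adaptiveMV vol ε τ n α - mvStar f α ≤ τ + 1 / quantileStar f (1 - ε) * (1 / n) := by
  have hε1 := hε.2
  have hn0 : (0 : ℝ) < n := by exact_mod_cast hn
  have hq := quantileStar_pos hf hb hflat (α := 1 - ε) ⟨by linarith [hε.2], by linarith [hε.1]⟩
  have hrhs : 0 ≤ 1 / quantileStar f (1 - ε) * (1 / n) := by positivity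
  change ∑ p ∈ leavesBelow vol ε τ (maxDepth n) 0 0,
    (nodeInterval ε p).indicator (fun _ => vol (dyadicLevel ε p.1 (p.2 + 1))) α - _ ≤ _
  by_cases hroot : α ∈ nodeInterval ε (0, 0)
  · obtain ⟨p, hp, hsub, hleaf, hsum⟩ :=
      exists_leaf_sum_leavesBelow vol hε1 τ (maxDepth n) 0 0 hroot
    rw [hsum]
    have hroot' : nodeInterval ε (0, 0) = Set.Ico 0 (1 - ε) := by
      simp [nodeInterval, dyadicLevel]
    rw [hroot'] at hsub
    have hlt := dyadicLevel_lt_succ hε1 p.1 p.2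
    obtain ⟨hl, hr⟩ := (Set.Ico_subset_Ico_iff hlt).1 hsub
    have hp1 : dyadicLevel ε p.1 p.2 ≤ α := hp.1
    have hp2 : α < dyadicLevel ε p.1 (p.2 + 1) := hp.2
    rcases hleaf with hj | hincr
    · have h1 := hvol _ ⟨hl.trans hlt.le, hr⟩
      have h2 := mvStar_sub_le hf hb hflat hd hα.1 hp2.le hr (by linarith [hε.1])
      have h3 : dyadicLevel ε p.1 (p.2 + 1) - α ≤ 1 / n := by
        have hlen := dyadicLevel_succ_sub ε p.1 p.2
        have hpow : (n : ℝ) ≤ 2 ^ p.1 := by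
          rw [hj, zero_add, maxDepth]
          exact_mod_cast (Nat.lt_pow_succ_log_self Nat.one_lt_two n).le
        have : (1 - ε) / 2 ^ p.1 ≤ 1 / n := by
          gcongr
          linarith [hε.1]
        linarith
      have h4 : (dyadicLevel ε p.1 (p.2 + 1) - α) / quantileStar f (1 - ε) ≤
          1 / quantileStar f (1 - ε) * (1 / n) := by
        rw [div_eq_inv_mul, ← one_div]
        gcongr
      linarith
    · have h1 := hvol _ ⟨hl, hlt.le.trans hr⟩
      have h2 := mvStar_mono hf hb hl hp1 (hα.2.trans_lt (by linarith [hε.1]))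
      linarith
  -- The endpoint `α = 1 - ε` is outside the half-open root interval, so the estimate is `0` there.
  · rw [sum_leavesBelow_of_notMem vol hε1 τ _ _ _ hroot]
    linarith [mvStar_nonneg f α]

/-- A volume function at most `2 κ` below another one splits, at tolerance `5 κ`, at most as often
as the other one at tolerance `3 κ`. -/
theorem splitCount_le_splitCount {vol V : ℝ → ℝ} {κ : ℝ} (hε : ε < 1)
    (hvol : ∀ α ∈ Set.Icc (0 : ℝ) (1 - ε), vol α ∈ Set.Icc (V α - 2 * κ) (V α)) (j : ℕ) :
    splitCount vol ε (5 * κ) j 0 (2 ^ j) ≤ splitCount V ε (3 * κ) j 0 (2 ^ j) := by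
  refine Finset.card_le_card fun k hk => ?_
  obtain ⟨hk, hs⟩ := Finset.mem_filter.1 hk
  refine Finset.mem_filter.2 ⟨hk, ?_⟩
  have hk' := (Finset.mem_Ico.1 hk).2
  have h1 := (hvol _ ⟨dyadicLevel_nonneg hε j (k + 1), dyadicLevel_le hε hk'⟩).2
  have h2 := (hvol _ ⟨dyadicLevel_nonneg hε j k, dyadicLevel_le hε hk'.le⟩).1
  linarith

/-- An increment at depth `j` is at most `(1-ε) / 2 ^ j` times the maximal slope `1 / Q*(1-ε)`,
which is below the threshold once `2 ^ j r > 1`. -/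
theorem splitCount_mvStar_eq_zero (hf : IsProbDensity f) (hb : BoundedDensity f)
    (hflat : NoFlatParts f) (hd : MVDerivLLogL f) (hε : ε ∈ Set.Ioo (0 : ℝ) 1) {r : ℝ} (hr : 0 < r)
    {j : ℕ} (hj : ¬ (2 : ℝ) ^ j ≤ 1 / r) :
    splitCount (mvStar f) ε (r / quantileStar f (1 - ε)) j 0 (2 ^ j) = 0 := by
  have hε1 := hε.2
  have hq := quantileStar_pos hf hb hflat (α := 1 - ε) ⟨by linarith [hε.2], by linarith [hε.1]⟩
  rw [splitCount, Finset.card_eq_zero, Finset.filter_eq_empty_iff]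
  intro k hk
  have hk' := (Finset.mem_Ico.1 hk).2
  have h := mvStar_sub_le hf hb hflat hd (dyadicLevel_nonneg hε1 j k)
    (dyadicLevel_lt_succ hε1 j k).le (dyadicLevel_le hε1 hk') (by linarith [hε.1])
  rw [not_lt]
  refine h.trans ?_
  rw [dyadicLevel_succ_sub]
  gcongr
  rw [not_le, div_lt_iff₀ hr] at hj
  rw [div_le_iff₀ (by positivity)]
  linarith [hε.1]

theorem sum_splitCount_mvStar_le (hf : IsProbDensity f) (hb : BoundedDensity f)
    (hflat : NoFlatParts f) (hd : MVDerivLLogL f) (hε : ε ∈ Set.Ioo (0 : ℝ) 1) {r : ℝ} (hr : 0 < r)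
    (J : ℕ) :
    (∑ j ∈ Finset.range J,
      (splitCount (mvStar f) ε (r / quantileStar f (1 - ε)) j 0 (2 ^ j) : ℝ)) ≤ 2 * (1 / r) := by
  refine le_trans ?_ (sum_two_pow_filter_le J (by positivity : 0 ≤ 1 / r))
  rw [Finset.sum_filter]
  refine Finset.sum_le_sum fun j _ => ?_
  split_ifs with h
  · exact_mod_cast splitCount_le_card _ _ _ _ _
  · rw [splitCount_mvStar_eq_zero hf hb hflat hd hε hr h, Nat.cast_zero]

/-- The number of leaves is controlled by the splitting nodes of the optimal curve. -/
theorem card_adaptiveLeaves_le_mvStar {vol V : ℝ → ℝ} {κ : ℝ} (hε : ε < 1)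
    (hvol : ∀ α ∈ Set.Icc (0 : ℝ) (1 - ε), vol α ∈ Set.Icc (V α - 2 * κ) (V α)) (n : ℕ) :
    ((adaptiveLeaves vol ε (5 * κ) n).card : ℝ) ≤
      max 1 (2 * ∑ j ∈ Finset.range (maxDepth n), (splitCount V ε (3 * κ) j 0 (2 ^ j) : ℝ)) := by
  rcases card_adaptiveLeaves_le vol ε (5 * κ) n with h | h
  · rw [h, Nat.cast_one]
    exact le_max_left _ _
  · refine le_trans ?_ (le_max_right _ _)
    have h' := h.trans (Nat.mul_le_mul_left 2 (Finset.sum_le_sum fun j _ =>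
      splitCount_le_splitCount hε hvol j))
    exact_mod_cast h'

/-- Both alternatives in the maximum are at most `(2 + K) / φ`: the single leaf because `φ ≤ K`, the
sum because it is geometric. Multiplying by `(1 + 1/ε) Q ‖MV*'‖ ≥ 1` gives the stated form. -/
theorem card_le_of_levels (hf : IsProbDensity f) (hb : BoundedDensity f)
    (hflat : NoFlatParts f) (hd : MVDerivLLogL f) (hε : ε ∈ Set.Ioo (0 : ℝ) 1) {φ K : ℝ}
    (hφ : 0 < φ) (hφK : φ ≤ K) {N : ℝ} {J : ℕ}
    (hN : N ≤ max 1 (2 * ∑ j ∈ Finset.range J,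
      (splitCount (mvStar f) ε (3 * φ / quantileStar f (1 - ε)) j 0 (2 ^ j) : ℝ))) :
    N ≤ (2 + K) * (1 + |ε|⁻¹) * quantileStar f (1 - ε) *
      (lLogLNorm (deriv (mvStar f)) / φ) := by
  have hL := le_quantileStar_mul_lLogLNorm hf hb hflat hd hε
  have hsum := sum_splitCount_mvStar_le hf hb hflat hd hε (by positivity : 0 < 3 * φ) J
  set q := quantileStar f (1 - ε)
  set L := lLogLNorm (deriv (mvStar f))
  have hε0 := hε.1
  have h1 : 1 ≤ (1 + |ε|⁻¹) * (q * L) := by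
    rw [abs_of_pos hε0]
    calc (1 : ℝ) = ε⁻¹ * ε := (inv_mul_cancel₀ hε0.ne').symm
      _ ≤ (1 + ε⁻¹) * (q * L) := by
        gcongr
        linarith
  have h2 : (2 + K) / φ ≤ (2 + K) * (1 + |ε|⁻¹) * q * (L / φ) := by
    have : (2 + K) * (1 + |ε|⁻¹) * q * (L / φ) = (2 + K) / φ * ((1 + |ε|⁻¹) * (q * L)) := by
      field_simp
    rw [this]
    exact le_mul_of_one_le_right (div_nonneg (by linarith) hφ.le) h1
  refine hN.trans ((max_le ?_ ?_).trans h2)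
  · rw [le_div_iff₀ hφ]
    linarith
  · refine (mul_le_mul_of_nonneg_left hsum zero_le_two).trans ?_
    rw [le_div_iff₀ hφ]
    have : 2 * (2 * (1 / (3 * φ))) * φ = 4 / 3 := by
      field_simp
      norm_num
    rw [this]
    linarith

/-- The support bounds the integral of the slope from below, so `v` is an admissible cut-off scale.
The factor `2` for leaves and `1/3` from the threshold `3 φ / Q` leave `2/3` to spare; the root
alone requires the maximum with `1`. -/
theorem card_le_of_volume (hf : IsProbDensity f) (hb : BoundedDensity f)
    (hflat : NoFlatParts f) (hd : MVDerivLLogL f) (hε : ε ∈ Set.Ioo (0 : ℝ) 1) {φ v : ℝ}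
    (hφ : 0 < φ) (hv : 0 < v) (hvf : ENNReal.ofReal v ≤ volume {x | 0 < f x}) {N : ℝ} {J : ℕ}
    (hN : N ≤ max 1 (2 * ∑ j ∈ Finset.range J,
      (splitCount (mvStar f) ε (3 * φ / quantileStar f (1 - ε)) j 0 (2 ^ j) : ℝ))) :
    N ≤ max 1 ((6 + 4 * Real.posLog v⁻¹) * quantileStar f (1 - ε) *
      (lLogLNorm (deriv (mvStar f)) / φ)) := by
  have hq := quantileStar_pos hf hb hflat (α := 1 - ε) ⟨by linarith [hε.2], by linarith [hε.1]⟩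
  have hvI : v ≤ ∫ x in Set.Ioo (0 : ℝ) 1, deriv (mvStar f) x := by
    have h := hvf.trans (volume_support_le hf hb hflat hd)
    by_contra! hlt
    exact absurd h (not_le.2 ((ENNReal.ofReal_lt_ofReal_iff hv).2 hlt))
  have hvL := hvI.trans (setIntegral_deriv_mvStar_le hd)
  have hsum := sum_splitCount_le (measurable_deriv (mvStar f)) (integrableOn_deriv_mvStar hd)
    (fun x hx => deriv_mvStar_nonneg hf hb hflat hd hx) hd.2
    (fun a b ha hab hb1 => integral_deriv_mvStar hd ha hab hb1) hε
    (by positivity : 0 < 3 * φ / quantileStar f (1 - ε)) hv hvL J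
  refine hN.trans (max_le_max le_rfl ?_)
  refine (mul_le_mul_of_nonneg_left hsum zero_le_two).trans ?_
  have hlog := Real.posLog_nonneg (x := v⁻¹)
  have hL0 : 0 < lLogLNorm (deriv (mvStar f)) := hv.trans_le hvL
  set q := quantileStar f (1 - ε)
  set L := lLogLNorm (deriv (mvStar f))
  have h1 : 2 * ((6 + 4 * Real.posLog v⁻¹) * (L / (3 * φ / q))) =
      2 / 3 * ((6 + 4 * Real.posLog v⁻¹) * q * (L / φ)) := by
    field_simp
  have h2 : 0 ≤ (6 + 4 * Real.posLog v⁻¹) * q * (L / φ) := by positivity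
  rw [h1]
  linarith

end MassVolume

/-! ### Assembly of the theorem -/

open MassVolume in
theorem theorem3 :
    -- `C` depends only on a lower bound of the volume of the support, `C'` only on `(ε, δ)`
    ∃ (C : ℝ → ℝ) (C' : ℝ → ℝ → ℝ), (∀ v, 0 < C v) ∧ (∀ ε δ, 0 < C' ε δ) ∧
    ∀ (d : ℕ) (f : Space d → ℝ), IsProbDensity f → BoundedDensity f → NoFlatParts f →
      MVDerivLLogL f →
    ∀ ε ∈ Set.Ioo (0 : ℝ) 1, ∀ δ ∈ Set.Ioo (0 : ℝ) 1,
    ∀ 𝒢 : Set (Set (Space d)), IsSetClass 𝒢 →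
      (∀ α ∈ Set.Icc (0 : ℝ) (1 - ε), ∃ A ∈ 𝒢, IsMinVolSet (law f) α A) →
      (∃ c > 0, ∀ m : ℕ, 1 ≤ m → rademacherAvg (law f) 𝒢 m ≤ c / Real.sqrt m) →
    ∀ (Ω : Type*) [MeasurableSpace Ω] (P : Measure Ω) [IsProbabilityMeasure P]
      (X : ℕ → Ω → Space d), (∀ i, Measurable (X i)) → (∀ i, P.map (X i) = law f) →
      iIndepFun X P →
    ∀ n : ℕ, 1 ≤ n →
    ∀ Ωhat : (Fin n → Space d) → ℝ → Set (Space d),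
      IsEmpMinVolEstimator 𝒢 (penalty (law f) 𝒢 n δ) ε n Ωhat →
    ∃ E : Set Ω, MeasurableSet E ∧ 1 - δ ≤ P.real E ∧ ∀ ω ∈ E,
      (∀ α ∈ Set.Icc (0 : ℝ) (1 - ε),
        adaptiveMV (empVol Ωhat fun i => X i ω) ε (tolerance f 𝒢 n δ ε) n α - mvStar f α ≤
          1 / quantileStar f (1 - ε) * (11 * penalty (law f) 𝒢 n δ + 1 / n)) ∧
      ((adaptiveLeaves (empVol Ωhat fun i => X i ω) ε (tolerance f 𝒢 n δ ε) n).card : ℝ) ≤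
        C' ε δ * quantileStar f (1 - ε) *
          (lLogLNorm (deriv (mvStar f)) / penalty (law f) 𝒢 n δ) ∧
      (∀ v > 0, ENNReal.ofReal v ≤ volume {x | 0 < f x} →
        ((adaptiveLeaves (empVol Ωhat fun i => X i ω) ε (tolerance f 𝒢 n δ ε) n).card : ℝ) ≤
          max 1 (C v * quantileStar f (1 - ε) *
            (lLogLNorm (deriv (mvStar f)) / penalty (law f) 𝒢 n δ))) := by

  -- The inner `2 + √(log(1/δ)/2)` is the bound `K` on the penalty. The absolute value keeps the
  -- constant positive for every real `ε`.
  refine ⟨fun v => 6 + 4 * Real.posLog v⁻¹,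
    fun ε δ => (2 + (2 + Real.sqrt (Real.log (1 / δ) / 2))) * (1 + |ε|⁻¹),
    fun v => by linarith [Real.posLog_nonneg (x := v⁻¹)], fun ε δ => by positivity, ?_⟩
  intro d f hf hb hflat hd ε hε δ hδ 𝒢 h𝒢 hmin hR Ω _ P _ X hX hlaw hind n hn Ωhat hΩ
  have := isProbabilityMeasure_law hf
  have hne : Nonempty 𝒢 := by
    obtain ⟨A, hA, -⟩ := hmin 0 ⟨le_rfl, by linarith [hε.2]⟩
    exact ⟨⟨A, hA⟩⟩
  set φ := penalty (law f) 𝒢 n δ with hφdef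
  have hφ : 0 < φ := penalty_pos (law f) 𝒢 hn hδ
  set S : Ω → Fin n → Space d := fun ω i => X i ω
  have hS : Measurable S := measurable_pi_lambda _ fun i => hX i
  have hmap : P.map S = Measure.pi fun _ => law f := by
    have h := (iIndepFun_iff_map_fun_eq_pi_map (f := fun (i : Fin n) => X i)
      fun i => (hX i).aemeasurable).1 (hind.precomp Fin.val_injective)
    simpa only [hlaw] using h
  have hm : MeasurableSet {x : Fin n → Space d | empDev (law f) 𝒢 x ≤ φ} :=
    measurableSet_le (measurable_empDev (law f) h𝒢 hn hR) measurable_const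
  refine ⟨S ⁻¹' {x | empDev (law f) 𝒢 x ≤ φ}, hS hm, ?_, fun ω hω => ?_⟩
  · have h := one_sub_le_measure_empDev_le (law f) h𝒢 hn hR hδ
    rwa [← hmap, map_measureReal_apply hS hm] at h
  have hω' : empDev (law f) 𝒢 (S ω) ≤ φ := hω
  have hx : ∀ A ∈ 𝒢, |empMass (S ω) A - (law f).real A| ≤ φ := fun A hA =>
    (abs_empMass_sub_le_empDev (law f) (S ω) hA).trans hω'
  have hvol : ∀ α ∈ Set.Icc (0 : ℝ) (1 - ε), empVol Ωhat (S ω) α ∈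
      Set.Icc (mvStar f α - 2 * φ / quantileStar f (1 - ε)) (mvStar f α) := fun α hα =>
    empVol_mem_Icc hf hb hflat hd hε h𝒢 hmin hφ.le hΩ hx hα
  have hq := quantileStar_pos hf hb hflat (α := 1 - ε) ⟨by linarith [hε.2], by linarith [hε.1]⟩
  have hcard := card_adaptiveLeaves_le_mvStar (κ := φ / quantileStar f (1 - ε)) hε.2
    (by simpa only [mul_div_assoc] using hvol) n
  rw [← mul_div_assoc, ← mul_div_assoc] at hcard
  refine ⟨fun α hα => ?_,
    card_le_of_levels hf hb hflat hd hε hφ (penalty_le (law f) 𝒢 hn hδ) hcard,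
    fun v hv hvf => card_le_of_volume hf hb hflat hd hε hφ hv hvf hcard⟩
  have h := adaptiveMV_sub_le hf hb hflat hd hε (fun α hα => (hvol α hα).2)
    (by positivity : 0 ≤ 5 * φ / quantileStar f (1 - ε)) hn hα
  refine h.trans ?_
  -- The argument yields `5 φ`, within the claimed `11 φ`.
  have h1 : 5 * φ / quantileStar f (1 - ε) ≤ 1 / quantileStar f (1 - ε) * (11 * φ) := by
    rw [one_div, ← div_eq_inv_mul]
    gcongr
    norm_num
  linarith
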